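/- Let $\mathbb F_r$ be a finite field of characteristic $p$ with $r$ elements, $A=\mathbb F_r[T]$, $k=\mathbb F_r(\theta)$ (an $A$-algebra through $T\mapsto\theta$), $K=\mathbb F_r((1/\theta))$ the completion of $k$ at $\infty$ (identified with $\mathbb F_r((1/T))$ when it contains values of $L$-series), and $G=\mathrm{Gal}(k^{\rm sep}/k)$. For $\beta\in k^*$ let $C^{(\beta)}$ be the rank one Drinfeld $A$-module over $k$ with $C^{(\beta)}_T(x)=\theta x+\beta x^r$, and let $C=C^{(1)}$ be the Carlitz module. For a Drinfeld module $\psi$ over $k$ and a prime $v=(g)$ of $A$ with $g$ monic irreducible, put $T_v(\psi)=\varprojlim_i\psi[v^i]$ and $H^1_v(\psi)=\mathrm{Hom}_{A_v}(T_v(\psi),k_v)$, with $G$ acting by $(\sigma h)(x)=h(\sigma^{-1}x)$; if this space is one-dimensional, let $\rho_{\psi,v}:G\to k_v^*$ be the resulting character. For a monic prime $f$ of $A$, also viewed as the prime $(f(\theta))$ of $\mathbb F_r[\theta]$, let $L_f(\psi,u)^{-1}=\det\bigl(1-u\,\mathrm{Frob}_f\mid H^1_v(\psi)^{I_f}\bigr)$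 for $v\neq(f)$, where $\mathrm{Frob}_f$ is a geometric Frobenius and $I_f$ an inertia group at $(f(\theta))$; this is required to be a polynomial over $A$, the same for all $v\ne(f)$. For a continuous character $\chi:G\to\mathbb F_r^*$ let $L_f(\chi,u)^{-1}=1-\chi(\mathrm{Frob}_f)u$ if $\chi$ is unramified at $(f(\theta))$, and $L_f(\chi,u)=1$ otherwise. Let $S_\infty=\bar K^*\times\mathbb Z_p$, written additively, and for $s=(x,y)\in S_\infty$ put $f^{-s}=x^{-\deg f}(f/T^{\deg f})^{-y}$. Put $L(\psi,s)=\prod_f L_f(\psi,f^{-s})$ and $L(\chi,s)=\prod_f L_f(\chi,f^{-s})$, regarded for each $y\in\mathbb Z_p$ as power series in $x^{-1}$ over $K$. An integer $j$ is embedded in $S_\infty$ as $(T^j,j)$. The module $\psi$ is modular of class I if there are $j\in\mathbb Z$ and a continuous character $\chi:G\to\mathbb F_r^*$ with trivial component at $\infty$ (that is, trivial on the decomposition groups at $\infty$) such that $L(\psi,s)=L(\chi,s-j)$. Let $\beta\in k^*$ and suppose that $\beta=\alpha^{r-1}$ for some $\alpha\in K$. Then: 1. $C^{(\beta)}_a(x)=\alpha^{-1}x\circ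 C_a(x)\circ\alpha x$ for all $a\in A$, and $C^{(\beta)}$ is isomorphic to $C$ over $K$. 2. For every $v$ the spaces $H^1_v(C)$ and $H^1_v(C^{(\beta)})$ are one-dimensional over $k_v$, and there is a continuous character $\chi_\beta:G\to\mathbb F_r^*$, independent of $v$, such that $\rho_{C^{(\beta)},v}=\chi_\beta\,\rho_{C,v}$ for all $v$; for each single $v$ it is the only homomorphism $G\to\mathbb F_r^*$ with this property. The component of $\chi_\beta$ at $\infty$ is trivial. 3. $C^{(\beta)}$ is modular of class I. In particular, the Carlitz module $C$ is modular of class I. Moreover $1+1/\theta$ is nonzero and is the $(r-1)$-st power of an element of $K$, so that $C^{(1+1/\theta)}$ is modular of class I as well. -/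

import Mathlib

open Polynomial

noncomputable section

/-! ### The base rings and fields

`F` is the finite field `𝔽_r`, `A = F[X]` is `𝔽_r[T]`, and `RatFunc F` is `k = 𝔽_r(θ)` (and also
the fraction field `𝔽_r(T)` of `A`). The structure map `A → k` sends `T` to `θ`. -/

/-- A monic prime of `A = 𝔽_r[T]`. -/
abbrev MonicPrime (F : Type*) [Field F] : Type _ := {g : F[X] // g.Monic ∧ Irreducible g}

/-- The place of `𝔽_r(T)` attached to a monic prime. -/
def MonicPrime.place {F : Type*} [Field F] (g : MonicPrime F) :
    IsDedekindDomain.HeightOneSpectrum F[X] where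
  asIdeal := Ideal.span {g.1}
  isPrime := (Ideal.span_singleton_prime g.2.2.ne_zero).2 g.2.2.prime
  ne_bot := by simpa [Ideal.span_singleton_eq_bot] using g.2.2.ne_zero

/-- The completed ring `A_v`, where `v = (g)`. -/
abbrev MonicPrime.Av {F : Type*} [Field F] (g : MonicPrime F) : Type _ :=
  g.place.adicCompletionIntegers (RatFunc F)

/-- The completed field `k_v`, where `v = (g)`. -/
abbrev MonicPrime.kv {F : Type*} [Field F] (g : MonicPrime F) : Type _ :=
  g.place.adicCompletion (RatFunc F)

open Classical in
/-- The field `𝔽_r((1/θ))`: the completion of `𝔽_r(θ)` at the infinite place. -/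
abbrev Kinf (F : Type*) [Field F] : Type _ := RatFunc.CompletionAtInfty F

instance Kinf.algebraPoly (F : Type*) [Field F] : Algebra F[X] (Kinf F) :=
  ((algebraMap (RatFunc F) (Kinf F)).comp (algebraMap F[X] (RatFunc F))).toAlgebra

instance Kinf.algebraConst (F : Type*) [Field F] : Algebra F (Kinf F) :=
  ((algebraMap F[X] (Kinf F)).comp (C : F →+* F[X])).toAlgebra

instance Kinf.tower (F : Type*) [Field F] : IsScalarTower F F[X] (Kinf F) :=
  IsScalarTower.of_algebraMap_eq fun _ => rfl

instance Kinf.tower' (F : Type*) [Field F] : IsScalarTower F[X] (RatFunc F) (Kinf F) :=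
  IsScalarTower.of_algebraMap_eq fun _ => rfl

/-- A separable closure `k^sep` of `k = 𝔽_r(θ)`. -/
abbrev kSep (F : Type*) [Field F] : Type _ := SeparableClosure (RatFunc F)

/-- `Gal(k^sep/k)`. -/
abbrev GalK (F : Type*) [Field F] : Type _ := kSep F ≃ₐ[RatFunc F] kSep F


/-! ### Drinfeld modules -/

/-- A Drinfeld `𝔽_r[T]`-module of positive rank over an `𝔽_r[T]`-field `L`, given by
`ψ_T(x) = θ x + ∑_{i=1}^{rank} a_i x^{r^i}` with `a_rank ≠ 0`; here `θ` is the image of `T`,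
and `coeff i` stands for `a_i` when `1 ≤ i ≤ rank`, with `a_0 = θ`. -/
structure DrinfeldModule (F L : Type*) [Field F] [Field L] [Algebra F[X] L] where
  rank : ℕ
  rank_pos : 0 < rank
  coeff : Fin (rank + 1) → L
  coeff_zero : coeff 0 = algebraMap F[X] L X
  coeff_rank : coeff (Fin.last rank) ≠ 0

namespace DrinfeldModule

section Basic

variable {F L : Type*} [Field F] [Fintype F] [Field L] [Algebra F[X] L]

/-- The polynomial `ψ_T(x)`. -/
def psiT (ψ : DrinfeldModule F L) : L[X] :=
  ∑ i : Fin (ψ.rank + 1), C (ψ.coeff i) * X ^ (Fintype.card F ^ (i : ℕ))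

/-- The polynomial `ψ_a(x)` for `a ∈ 𝔽_r[T]`: if `a = ∑ c_j T^j` then `ψ_a = ∑ c_j ψ_T^{∘ j}`. -/
def psi (ψ : DrinfeldModule F L) (a : F[X]) : L[X] :=
  a.sum fun j c => C (algebraMap F[X] L (C c)) * (fun q : L[X] => ψ.psiT.comp q)^[j] X

/-- Base change of a Drinfeld module along an extension of `𝔽_r[T]`-fields. -/
def baseChange (ψ : DrinfeldModule F L) (M : Type*) [Field M] [Algebra F[X] M] [Algebra L M]
    [IsScalarTower F[X] L M] : DrinfeldModule F M where
  rank := ψ.rank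
  rank_pos := ψ.rank_pos
  coeff i := algebraMap L M (ψ.coeff i)
  coeff_zero := by rw [ψ.coeff_zero, ← IsScalarTower.algebraMap_apply]
  coeff_rank := by simpa using ψ.coeff_rank

/-- Isomorphism of Drinfeld modules over `L`: an `𝔽_r`-linear polynomial `u` over `L` that is
invertible for composition and satisfies `u ∘ φ_a = ψ_a ∘ u` for all `a`. -/
def Isomorphic (φ ψ : DrinfeldModule F L) : Prop :=
  ∃ u w : L[X], (∀ n ∈ u.support, ∃ i : ℕ, n = Fintype.card F ^ i) ∧
    (∀ n ∈ w.support, ∃ i : ℕ, n = Fintype.card F ^ i) ∧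
    u.comp w = X ∧ w.comp u = X ∧ ∀ a : F[X], u.comp (φ.psi a) = (ψ.psi a).comp u

end Basic

section Points

variable {F L : Type*} [Field F] [Fintype F] [Field L] [Algebra F[X] L] [Algebra F L]

/-- The `𝔽_r`-linear map `x ↦ ψ_T(x)` on `L`. -/
def psiEnd (ψ : DrinfeldModule F L) : Module.End F L :=
  ∑ i : Fin (ψ.rank + 1),
    LinearMap.mulLeft F (ψ.coeff i) * (FiniteField.frobeniusAlgHom F L).toLinearMap ^ (i : ℕ)

/-- The group `L` with the `𝔽_r[T]`-module structure in which `a` acts as `x ↦ ψ_a(x)`. -/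
abbrev Points (ψ : DrinfeldModule F L) : Type _ := Module.AEval' ψ.psiEnd

theorem psiEnd_apply (ψ : DrinfeldModule F L) (x : L) : ψ.psiEnd x = ψ.psiT.eval x := by
  have h : ∀ (i : ℕ) (y : L),
      ((FiniteField.frobeniusAlgHom F L).toLinearMap ^ i) y = y ^ (Fintype.card F ^ i) := by
    intro i
    induction i with
    | zero => intro y; simp
    | succ i ih => intro y; rw [pow_succ, Module.End.mul_apply, ih]; simp [← pow_mul, pow_succ']
  simp [psiEnd, psiT, eval_finsetSum, h]

/-- The element `a` acts on `Points` by `x ↦ ψ_a(x)`. -/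
theorem smul_point [IsScalarTower F F[X] L] (ψ : DrinfeldModule F L) (a : F[X]) (x : L) :
    a • (Module.AEval'.of ψ.psiEnd x) = Module.AEval'.of ψ.psiEnd ((ψ.psi a).eval x) := by
  have h : ∀ j : ℕ, ((fun q : L[X] => ψ.psiT.comp q)^[j] X).eval x = (ψ.psiEnd ^ j) x := by
    intro j
    induction j with
    | zero => simp
    | succ j ih =>
      rw [Function.iterate_succ_apply', eval_comp, ih, pow_succ', Module.End.mul_apply,
        psiEnd_apply]
  rw [← Module.AEval.of_aeval_smul]
  congr 1
  simp only [psi, Polynomial.sum, eval_finsetSum, eval_mul, eval_C, h]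
  rw [aeval_def, eval₂_eq_sum, Polynomial.sum, Module.End.smul_def, LinearMap.sum_apply]
  refine Finset.sum_congr rfl fun j _ => ?_
  rw [Module.End.mul_apply, Module.algebraMap_end_apply, Algebra.smul_def,
    IsScalarTower.algebraMap_apply F F[X] L]
  rfl

end Points

end DrinfeldModule

/-! ### Tate modules -/

namespace MonicPrime

variable {F : Type*} [Field F]

open WithZero in
theorem exists_approx (g : MonicPrime F) (a : g.Av) (n : ℕ) :
    ∃ b : F[X], Valued.v ((a : g.kv) - algebraMap F[X] g.kv b) ≤ exp (-(n : ℤ)) := by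
  have hd := IsDedekindDomain.HeightOneSpectrum.denseRange_algebraMap (R := F[X])
    (RatFunc F) g.place
  have hex : ∃ x : RatFunc F, Valued.v ((a : g.kv) - algebraMap (RatFunc F) g.kv x) ≤
      exp (-(n : ℤ)) := by
    have hg : Valued.v (algebraMap (RatFunc F) g.kv (algebraMap F[X] (RatFunc F) (g.1 ^ n))) =
        exp (-(n : ℤ)) := by
      refine (IsDedekindDomain.HeightOneSpectrum.valuedAdicCompletion_eq_valuation' g.place
        (algebraMap F[X] (RatFunc F) (g.1 ^ n))).trans ?_
      rw [IsDedekindDomain.HeightOneSpectrum.valuation_of_algebraMap, map_pow,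
        g.place.intValuation_singleton g.2.2.ne_zero rfl, ← exp_nsmul]
      simp
    generalize algebraMap (RatFunc F) g.kv (algebraMap F[X] (RatFunc F) (g.1 ^ n)) = c at hg
    have ho : IsOpen {z : g.kv | Valued.v z ≤ exp (-(n : ℤ))} := by
      have hs : {z : g.kv | Valued.v z ≤ exp (-(n : ℤ))} =
          {z : g.kv | Valued.v.restrict z ≤ Valued.v.restrict c} :=
        Set.ext fun z => by
          change Valued.v z ≤ _ ↔ Valued.v.restrict z ≤ Valued.v.restrict c
          rw [Valuation.restrict_le_iff, hg]
      rw [hs]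
      refine Valued.isOpen_closedBall _ ?_
      rw [Valuation.ne_zero_iff]
      intro h0
      rw [h0, map_zero] at hg
      exact exp_ne_zero hg.symm
    obtain ⟨x, hx⟩ := hd.exists_mem_open (ho.preimage (continuous_const.sub continuous_id))
      ⟨(a : g.kv), by
        change Valued.v ((a : g.kv) - (a : g.kv)) ≤ _
        rw [sub_self, map_zero]
        exact zero_le⟩
    exact ⟨x, hx⟩
  obtain ⟨x, hx⟩ := hex
  have hvx := IsDedekindDomain.HeightOneSpectrum.valuedAdicCompletion_eq_valuation' g.place x
  have hle : g.place.valuation (RatFunc F) x ≤ 1 := by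
    rw [← hvx]
    have h1 : Valued.v (a : g.kv) ≤ 1 := a.2
    have h2 : (algebraMap (RatFunc F) g.kv x) =
        (a : g.kv) - ((a : g.kv) - algebraMap (RatFunc F) g.kv x) := (sub_sub_cancel _ _).symm
    change Valued.v (algebraMap (RatFunc F) g.kv x) ≤ 1
    rw [h2]
    refine (Valuation.map_sub _ _ _).trans (max_le h1 (hx.trans ?_))
    rw [← exp_zero, exp_le_exp]
    omega
  obtain ⟨b, hb⟩ := g.place.exists_valuation_sub_lt_of_integer hle
    (Units.mk0 (exp (-(n : ℤ))) exp_ne_zero)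
  refine ⟨b, ?_⟩
  have hvb := IsDedekindDomain.HeightOneSpectrum.valuedAdicCompletion_eq_valuation' g.place
    (algebraMap F[X] (RatFunc F) b - x)
  rw [← hvb] at hb
  have h3 : (a : g.kv) - algebraMap F[X] g.kv b =
      ((a : g.kv) - algebraMap (RatFunc F) g.kv x) -
        algebraMap (RatFunc F) g.kv (algebraMap F[X] (RatFunc F) b - x) := by
    rw [map_sub, ← IsScalarTower.algebraMap_apply, sub_sub_sub_cancel_right]
  rw [h3]
  exact (Valuation.map_sub _ _ _).trans (max_le hx hb.le)

open WithZero in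
theorem smul_eq_zero_of_approx (g : MonicPrime F) {E : Type*} [AddCommGroup E] [Module F[X] E]
    {n : ℕ} {b : F[X]} (hb : Valued.v (algebraMap F[X] g.kv b) ≤ exp (-(n : ℤ))) {x : E}
    (hx : g.1 ^ n • x = 0) : b • x = 0 := by
  have h1 : g.place.intValuation b ≤ exp (-(n : ℤ)) := by
    rw [IsScalarTower.algebraMap_apply F[X] (RatFunc F) g.kv] at hb
    have := IsDedekindDomain.HeightOneSpectrum.valuedAdicCompletion_eq_valuation'
      g.place (algebraMap F[X] (RatFunc F) b)
    rw [IsDedekindDomain.HeightOneSpectrum.valuation_of_algebraMap] at this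
    rw [← this]
    exact hb
  rw [IsDedekindDomain.HeightOneSpectrum.intValuation_le_pow_iff_mem] at h1
  have h2 : b ∈ Ideal.span {g.1 ^ n} := by
    rw [← Ideal.span_singleton_pow]; exact h1
  obtain ⟨c, rfl⟩ := Ideal.mem_span_singleton.1 h2
  rw [mul_comm, mul_smul, hx, smul_zero]

/-- The `g`-adic Tate module of an `𝔽_r[T]`-module `E`: the inverse limit of the groups
`E[g^n]` along the maps `x ↦ g x` from `E[g^{n+1}]` to `E[g^n]`. -/
def Tate (g : MonicPrime F) (E : Type*) [AddCommGroup E] [Module F[X] E] : AddSubgroup (ℕ → E) where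
  carrier := {x | (∀ n, g.1 ^ n • x n = 0) ∧ ∀ n, g.1 • x (n + 1) = x n}
  add_mem' := fun {x y} hx hy =>
    ⟨fun n => by simp [hx.1 n, hy.1 n], fun n => by simp [hx.2 n, hy.2 n]⟩
  zero_mem' := ⟨fun n => by simp, fun n => by simp⟩
  neg_mem' := fun {x} hx => ⟨fun n => by simp [hx.1 n], fun n => by simp [hx.2 n]⟩

/-- A polynomial congruent to `a ∈ A_v` modulo `g^n A_v`. -/
def approx (g : MonicPrime F) (a : g.Av) (n : ℕ) : F[X] := (g.exists_approx a n).choose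

section TateModule

variable (g : MonicPrime F) {E : Type*} [AddCommGroup E] [Module F[X] E]

open WithZero in
theorem approx_smul {a : g.Av} {n : ℕ} {b : F[X]}
    (hb : Valued.v ((a : g.kv) - algebraMap F[X] g.kv b) ≤ exp (-(n : ℤ))) {x : E}
    (hx : g.1 ^ n • x = 0) : g.approx a n • x = b • x := by
  rw [← sub_eq_zero, ← sub_smul]
  refine g.smul_eq_zero_of_approx ?_ hx
  have h : algebraMap F[X] g.kv (g.approx a n - b) = ((a : g.kv) - algebraMap F[X] g.kv b) -
      ((a : g.kv) - algebraMap F[X] g.kv (g.approx a n)) := by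
    rw [map_sub]; ring
  rw [h]
  exact (Valuation.map_sub _ _ _).trans (max_le hb (g.exists_approx a n).choose_spec)

open WithZero in
theorem approx_spec (a : g.Av) (n : ℕ) :
    Valued.v ((a : g.kv) - algebraMap F[X] g.kv (g.approx a n)) ≤ exp (-(n : ℤ)) :=
  (g.exists_approx a n).choose_spec

/-- `A_v` acts on the Tate module through the actions of `A_v/g^n A_v = A/g^n A` on `E[g^n]`. -/
instance Tate.instSMul : SMul g.Av (g.Tate E) where
  smul a x := ⟨fun n => g.approx a n • x.1 n, by
    refine ⟨fun n => by rw [smul_comm, x.2.1 n, smul_zero], fun n => ?_⟩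
    rw [smul_comm, x.2.2 n]
    refine (g.approx_smul ?_ (x.2.1 n)).symm
    refine (g.approx_spec a (n + 1)).trans ?_
    rw [WithZero.exp_le_exp]
    push_cast
    omega⟩

theorem Tate.smul_apply (a : g.Av) (x : g.Tate E) (n : ℕ) :
    (a • x).1 n = g.approx a n • x.1 n := rfl

instance Tate.instModule : Module g.Av (g.Tate E) where
  one_smul x := by
    ext n
    rw [Tate.smul_apply, g.approx_smul (b := 1) (by simp) (x.2.1 n), one_smul]
  mul_smul a b x := by
    ext n
    rw [Tate.smul_apply, Tate.smul_apply, Tate.smul_apply,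
      g.approx_smul (b := g.approx a n * g.approx b n) ?_ (x.2.1 n), mul_smul]
    have h : ((a * b : g.Av) : g.kv) - algebraMap F[X] g.kv (g.approx a n * g.approx b n) =
        (a : g.kv) * ((b : g.kv) - algebraMap F[X] g.kv (g.approx b n)) +
          ((a : g.kv) - algebraMap F[X] g.kv (g.approx a n)) *
            algebraMap F[X] g.kv (g.approx b n) := by
      rw [map_mul]; push_cast; ring
    rw [h]
    refine (Valuation.map_add _ _ _).trans (max_le ?_ ?_)
    · rw [map_mul]
      exact mul_le_of_le_one_of_le a.2 (g.approx_spec b n)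
    · rw [map_mul]
      exact mul_le_of_le_of_le_one (g.approx_spec a n)
        (IsDedekindDomain.HeightOneSpectrum.coe_algebraMap_mem _ _ g.place (g.approx b n))
  smul_zero a := by
    ext n
    rw [Tate.smul_apply]
    exact smul_zero _
  smul_add a x y := by
    ext n
    exact smul_add _ _ _
  add_smul a b x := by
    ext n
    rw [Tate.smul_apply, g.approx_smul (b := g.approx a n + g.approx b n) ?_ (x.2.1 n), add_smul]
    · rfl
    · have h : ((a + b : g.Av) : g.kv) - algebraMap F[X] g.kv (g.approx a n + g.approx b n) =
          ((a : g.kv) - algebraMap F[X] g.kv (g.approx a n)) +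
            ((b : g.kv) - algebraMap F[X] g.kv (g.approx b n)) := by
        rw [map_add]; push_cast; ring
      rw [h]
      exact (Valuation.map_add _ _ _).trans (max_le (g.approx_spec a n) (g.approx_spec b n))
  zero_smul x := by
    ext n
    rw [Tate.smul_apply, g.approx_smul (b := 0) (by simp) (x.2.1 n), zero_smul]
    rfl

/-- The map on Tate modules induced by an `𝔽_r[T]`-linear map. -/
def Tate.map (u : E →ₗ[F[X]] E) : g.Tate E →ₗ[g.Av] g.Tate E where
  toFun x := ⟨fun n => u (x.1 n), fun n => by rw [← map_smul, x.2.1 n, map_zero],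
    fun n => by rw [← map_smul, x.2.2 n]⟩
  map_add' x y := by ext n; exact map_add u _ _
  map_smul' a x := by ext n; exact map_smul u _ _

end TateModule

end MonicPrime

/-! ### The Galois representations of a Drinfeld module over `k` -/

namespace DrinfeldModule

variable {F : Type*} [Field F] [Fintype F]

/-- The `𝔽_r[T]`-module `ψ(k^sep)`. All torsion points are separable over `k`. -/
abbrev SepPoints (ψ : DrinfeldModule F (RatFunc F)) : Type _ := (ψ.baseChange (kSep F)).Points

theorem psiEnd_galois (ψ : DrinfeldModule F (RatFunc F)) (σ : GalK F) (x : kSep F) :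
    σ ((ψ.baseChange (kSep F)).psiEnd x) = (ψ.baseChange (kSep F)).psiEnd (σ x) := by
  simp [psiEnd_apply, psiT, eval_finsetSum, baseChange]

/-- The action of `σ ∈ Gal(k^sep/k)` on `ψ(k^sep)`. -/
def galPoint (ψ : DrinfeldModule F (RatFunc F)) (σ : GalK F) :
    ψ.SepPoints →ₗ[F[X]] ψ.SepPoints :=
  LinearMap.ofAEval _ (((Module.AEval'.of (ψ.baseChange (kSep F)).psiEnd).toLinearMap).comp
    ((σ.toAlgHom.restrictScalars F).toLinearMap)) fun x => by
      rw [LinearMap.comp_apply, LinearMap.comp_apply]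
      change _ = (X : F[X]) • Module.AEval'.of (ψ.baseChange (kSep F)).psiEnd (σ x)
      rw [Module.AEval'.X_smul_of]
      exact congrArg _ (ψ.psiEnd_galois σ x)

/-- `T_v(ψ)` for `v = (g)`. -/
abbrev TateModule (ψ : DrinfeldModule F (RatFunc F)) (g : MonicPrime F) : Type _ :=
  g.Tate ψ.SepPoints

/-- `H^1_v(ψ) = Hom_{A_v}(T_v(ψ), k_v)` for `v = (g)`. -/
abbrev H1 (ψ : DrinfeldModule F (RatFunc F)) (g : MonicPrime F) : Type _ :=
  ψ.TateModule g →ₗ[g.Av] g.kv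

/-- The Galois representation on `H^1_v(ψ)`: `(σ h)(x) = h(σ⁻¹ x)`. -/
def h1Rep (ψ : DrinfeldModule F (RatFunc F)) (g : MonicPrime F) :
    Representation g.kv (GalK F) (ψ.H1 g) where
  toFun σ :=
    { toFun := fun h => h.comp (MonicPrime.Tate.map g (ψ.galPoint σ⁻¹))
      map_add' := fun _ _ => rfl
      map_smul' := fun _ _ => rfl }
  map_one' := by
    refine LinearMap.ext fun h => LinearMap.ext fun x => congrArg h ?_
    ext n
    change ψ.galPoint 1⁻¹ (x.1 n) = x.1 n
    rw [inv_one]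
    rfl
  map_mul' σ τ := by
    refine LinearMap.ext fun h => LinearMap.ext fun x => congrArg h ?_
    ext n
    change ψ.galPoint (σ * τ)⁻¹ (x.1 n) = ψ.galPoint τ⁻¹ (ψ.galPoint σ⁻¹ (x.1 n))
    rw [mul_inv_rev]
    rfl

/-- The `k_v`-valued function `ρ_{ψ,v}` of a Drinfeld module `ψ` for which `H^1_v(ψ)` is
one-dimensional: `σ` acts on `H^1_v(ψ)` as multiplication by `ρ_{ψ,v}(σ)`, which is the
determinant of the action. -/
def rho (ψ : DrinfeldModule F (RatFunc F)) (g : MonicPrime F) (σ : GalK F) : g.kv :=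
  LinearMap.det (ψ.h1Rep g σ)

end DrinfeldModule

/-! ### Places of `k^sep`, inertia, Frobenius, and the component at infinity -/

section Places

variable {F : Type*} [Field F]

/-- The valuation ring `B` of `k^sep` lies over the finite place `(f(θ))` of `k`. -/
def LiesOverPrime (B : ValuationSubring (kSep F)) (f : MonicPrime F) : Prop :=
  B.comap (algebraMap (RatFunc F) (kSep F)) = (f.place.valuation (RatFunc F)).valuationSubring

open Classical in
/-- The valuation ring `B` of `k^sep` lies over the infinite place of `k`. -/
def LiesOverInfinity (B : ValuationSubring (kSep F)) : Prop :=
  B.comap (algebraMap (RatFunc F) (kSep F)) = (RatFunc.inftyValuation F).valuationSubring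

/-- `σ` is a geometric Frobenius at the place `B` of `k^sep` over `f`: it stabilizes `B`, and
`σ⁻¹` acts on the residue field of `B` as `x ↦ x^{r^{deg f}}`. -/
def IsGeomFrob [Fintype F] (B : ValuationSubring (kSep F)) (f : MonicPrime F) (σ : GalK F) : Prop :=
  σ ∈ B.decompositionSubgroup (RatFunc F) ∧
    ∀ x ∈ B, σ⁻¹ x - x ^ (Fintype.card F ^ f.1.natDegree) ∈ B.nonunits

/-- `P ∈ A[u]` is the reciprocal `L_f(ψ,u)⁻¹` of the local factor of `ψ` at `f`: for every prime
`v ≠ f`, every place `B` over `f` and every geometric Frobenius `σ` at `B`, it equals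
`det (1 - u σ | H^1_v(ψ)^I)`, with `I` the inertia group of `B`. Here `b` is a basis of the
space of inertia invariants and `m` is the matrix of `σ` in that basis. -/
def DrinfeldModule.IsEulerPoly [Fintype F] (ψ : DrinfeldModule F (RatFunc F)) (f : MonicPrime F)
    (P : F[X][X]) : Prop :=
  ∀ v : MonicPrime F, v ≠ f → ∀ B : ValuationSubring (kSep F), LiesOverPrime B f →
    ∀ σ : GalK F, IsGeomFrob B f σ →
      ∃ (n : ℕ) (b : Fin n → ψ.H1 v) (m : Matrix (Fin n) (Fin n) v.kv),
        LinearIndependent v.kv b ∧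
        (∀ h : ψ.H1 v, h ∈ Submodule.span v.kv (Set.range b) ↔
          ∀ τ ∈ B.inertiaSubgroup (RatFunc F), ψ.h1Rep v τ h = h) ∧
        (∀ i, ψ.h1Rep v σ (b i) = ∑ j, m j i • b j) ∧
        P.map (algebraMap F[X] v.kv) = m.charpolyRev

/-- `P` is the reciprocal `L_f(χ,u)⁻¹` of the local factor at `f` of an `𝔽_r^*`-valued character
`χ`: it is `1 - χ(Frob_f) u` when `χ` is unramified at `f`, and `1` otherwise. -/
def IsCharEulerPoly [Fintype F] (χ : GalK F →* Fˣ) (f : MonicPrime F) (P : F[X][X]) : Prop :=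
  ∀ B : ValuationSubring (kSep F), LiesOverPrime B f →
    ((∀ τ ∈ B.inertiaSubgroup (RatFunc F), χ τ = 1) →
      ∀ σ : GalK F, IsGeomFrob B f σ → P = 1 - C (C (χ σ : F)) * X) ∧
    ((¬ ∀ τ ∈ B.inertiaSubgroup (RatFunc F), χ τ = 1) → P = 1)

/-- The component of `χ` at `∞` is trivial: `χ` is trivial on the decomposition groups at `∞`. -/
def TrivialAtInfinity (χ : GalK F →* Fˣ) : Prop :=
  ∀ B : ValuationSubring (kSep F), LiesOverInfinity B →
    ∀ σ ∈ B.decompositionSubgroup (RatFunc F), χ σ = 1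

/-- Continuity of an `𝔽_r^*`-valued character of `Gal(k^sep/k)`. -/
def IsContinuousChar (χ : GalK F →* Fˣ) : Prop := IsOpen (χ.ker : Set (GalK F))

end Places

/-! ### `L`-series on `S_∞` and modularity of class I -/

section LSeries

variable {F : Type*} [Field F] (p : ℕ) [Fact p.Prime] [CharP F p]

/-- `u^y = ∑_n binom(y,n) (u-1)^n` for a one-unit `u` of `𝔽_r((1/θ))` and `y ∈ ℤ_p`. -/
def oneUnitPow (u : Kinf F) (y : ℤ_[p]) : Kinf F :=
  ∑' n : ℕ, algebraMap F (Kinf F)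
    (ZMod.castHom (dvd_refl p) F (PadicInt.toZMod (Ring.choose y n))) * (u - 1) ^ n

/-- The image of `T` in `𝔽_r((1/T))`. -/
def Kinf.T (F : Type*) [Field F] : Kinf F := algebraMap F[X] (Kinf F) X

/-- The one-unit part `⟨f⟩ = f / T^{deg f}` of a monic prime. -/
def MonicPrime.oneUnit (f : MonicPrime F) : Kinf F :=
  algebraMap F[X] (Kinf F) f.1 / Kinf.T F ^ f.1.natDegree

/-- For `s = (x,y) ∈ S_∞` one has `f^{-s} = x^{-deg f} ⟨f⟩^{-y}`. This is the Euler factor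
`1 / P(f^{-s})` for fixed `y`, as a formal power series in `x⁻¹` (the variable `X` below). -/
def eulerFactor (f : MonicPrime F) (P : F[X][X]) (y : ℤ_[p]) : PowerSeries (Kinf F) :=
  (P.eval₂ ((PowerSeries.C : Kinf F →+* PowerSeries (Kinf F)).comp (algebraMap F[X] (Kinf F)))
    (PowerSeries.C (oneUnitPow p f.oneUnit (-y)) * PowerSeries.X ^ f.1.natDegree))⁻¹

/-- The `L`-series `s = (x,y) ↦ ∏_f 1 / P_f(f^{-s})`, for fixed `y` expanded as a power series in
`x⁻¹`. For polynomials `P_f` with constant term `1` the factor of `f` is `1 + O(x^{-deg f})`, so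
the coefficient of `x^{-n}` in the product involves only the finitely many `f` of degree at most
`n`. -/
def LSeriesOf (P : MonicPrime F → F[X][X]) (y : ℤ_[p]) : PowerSeries (Kinf F) :=
  PowerSeries.mk fun n => PowerSeries.coeff n
    (∏ᶠ (f : MonicPrime F) (_ : f.1.natDegree ≤ n), eulerFactor p f (P f) y)

/-- The translate `s ↦ L(s - j)` of an `L`-series by an integer `j`, embedded in `S_∞` as
`s_j = (T^j, j)`: `(x,y) - s_j = (x T^{-j}, y - j)`, so `x⁻¹` is replaced by `T^j x⁻¹`. -/
def integralTranslate (j : ℤ) (L : ℤ_[p] → PowerSeries (Kinf F)) (y : ℤ_[p]) : PowerSeries (Kinf F) :=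
  PowerSeries.rescale (Kinf.T F ^ j) (L (y - j))

/-- A Drinfeld module over `k = 𝔽_r(θ)` is modular of class I if its `L`-series is an integral
translate of the `L`-series of a finite `𝔽_r^*`-valued character of `Gal(k^sep/k)` whose
component at `∞` is trivial. -/
def DrinfeldModule.IsModularClassI [Fintype F] (ψ : DrinfeldModule F (RatFunc F)) : Prop :=
  ∃ (χ : GalK F →* Fˣ) (P Q : MonicPrime F → F[X][X]) (j : ℤ),
    IsContinuousChar χ ∧ TrivialAtInfinity χ ∧
    (∀ f, ψ.IsEulerPoly f (P f)) ∧ (∀ f, IsCharEulerPoly χ f (Q f)) ∧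
    LSeriesOf p P = integralTranslate p j (LSeriesOf p Q)

end LSeries

/-! ### The rank one Drinfeld modules `C^{(β)}` -/

/-- `C^{(β)}_T(x) = θ x + β x^r`, for `β ∈ 𝔽_r(θ)^*`. -/
def carlitzTwist {F : Type*} [Field F] (β : RatFunc F) (hβ : β ≠ 0) :
    DrinfeldModule F (RatFunc F) where
  rank := 1
  rank_pos := one_pos
  coeff := ![algebraMap F[X] (RatFunc F) X, β]
  coeff_zero := rfl
  coeff_rank := hβ

/-- The Carlitz module `C_T(x) = θ x + x^r`. -/
def carlitz (F : Type*) [Field F] : DrinfeldModule F (RatFunc F) := carlitzTwist 1 one_ne_zero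

end

open Polynomial

noncomputable section

/-! Choose `γ` in `k^sep` with `γ^(r-1) = β`. Multiplication by `γ` identifies `C^{(β)}(k^sep)` with
`C(k^sep)`, and `σγ = χ(σ)γ` for a Kummer character `χ` with values in `𝔽_r^*`. The representations
of `C^{(β)}` are therefore those of `C` multiplied by `χ` (`twistH1_h1Rep`). If `β` is an `(r-1)`-st
power in `K`, then `χ` is trivial on the decomposition groups at `∞`
(`IsKummerChar.trivialAtInfinity`).

For `C` itself, `C_a` is monic of degree `r^{deg a}` with constant derivative `a`. Root counting
shows that `T_v(C)` is free of rank one over `A_v` (`MonicPrime.Tate.exists_equiv`). At `f ≠ v`,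
reduction is injective on `v`-power torsion, so inertia acts trivially. Moreover `C_f ≡ x^{r^{deg
f}}` modulo `f` (`exists_carlitzPoly_eq_X_pow_add`), so the inverse of a geometric Frobenius acts on
torsion as `C_f`, and the geometric Frobenius acts on `H^1_v(C)` as the scalar `f`.

Let `c_f` be `χ(Frob_f)` if `χ` is unramified at `f` and `0` otherwise; conjugacy of the places over
`f` makes it well defined. The reciprocal local factors are `1 - c_f f u` for `C^{(β)}` and `1 - c_f
u` for `χ`. Since `f · f^{-s} = f^{-(s-1)}`, the two Euler products satisfy `L(C^{(β)}, s) = L(χ, s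
- 1)`, which is modularity of class I with `j = 1`. -/

/-! ### Carlitz polynomials over `𝔽_r[θ]` -/

section CarlitzPoly

variable {F : Type*} [Field F] [Fintype F]

/-- The iterates of `C_T(x) = θ x + x^r`, as polynomials over `𝔽_r[θ]`. -/
def carlitzIter (F : Type*) [Field F] [Fintype F] (j : ℕ) : F[X][X] :=
  (fun q : F[X][X] => (C X * X + X ^ Fintype.card F : F[X][X]).comp q)^[j] X

/-- The polynomial `C_a(x)` over `𝔽_r[θ]`. -/
def carlitzPoly (a : F[X]) : F[X][X] := a.sum fun j c => C (C c) * carlitzIter F j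

theorem carlitzIter_zero : carlitzIter F 0 = X := rfl

theorem carlitzIter_succ (j : ℕ) :
    carlitzIter F (j + 1) = C X * carlitzIter F j + carlitzIter F j ^ Fintype.card F := by
  rw [carlitzIter, Function.iterate_succ_apply', ← carlitzIter]
  simp

theorem carlitzIter_monic_natDegree (j : ℕ) :
    (carlitzIter F j).Monic ∧ (carlitzIter F j).natDegree = Fintype.card F ^ j := by
  have hr : 1 < Fintype.card F := Fintype.one_lt_card
  induction j with
  | zero => simp [carlitzIter_zero, monic_X]
  | succ j ih =>
    have hm := ih.1.pow (Fintype.card F)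
    have hd : (carlitzIter F j ^ Fintype.card F).natDegree = Fintype.card F ^ (j + 1) := by
      rw [ih.1.natDegree_pow, ih.2, pow_succ']
    have hlt : (C X * carlitzIter F j : F[X][X]).natDegree <
        (carlitzIter F j ^ Fintype.card F).natDegree := by
      rw [hd]
      refine (natDegree_C_mul_le _ _).trans_lt ?_
      rw [ih.2]
      exact Nat.pow_lt_pow_right hr (Nat.lt_succ_self j)
    rw [carlitzIter_succ]
    exact ⟨hm.add_of_right (degree_lt_degree hlt), by
      rw [natDegree_add_eq_right_of_natDegree_lt hlt, hd]⟩

theorem derivative_carlitzIter (j : ℕ) : derivative (carlitzIter F j) = C (X ^ j) := by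
  have hr : ((Fintype.card F : ℕ) : F[X][X]) = 0 := by
    have h : ((Fintype.card F : ℕ) : F) = 0 := Nat.cast_card_eq_zero F
    rw [← map_natCast (C : F[X] →+* F[X][X]), ← map_natCast (C : F →+* F[X]), h, C_0, C_0]
  induction j with
  | zero => simp [carlitzIter_zero]
  | succ j ih => simp [carlitzIter_succ, derivative_pow, ih, hr, pow_succ']

theorem carlitzIter_coeff_zero (j : ℕ) : (carlitzIter F j).coeff 0 = 0 := by
  induction j with
  | zero => simp [carlitzIter_zero]
  | succ j ih =>
    rw [coeff_zero_eq_eval_zero] at ih ⊢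
    simp [carlitzIter_succ, ih]

theorem carlitzPoly_monic_natDegree {a : F[X]} (ha : a.Monic) :
    (carlitzPoly a).Monic ∧ (carlitzPoly a).natDegree = Fintype.card F ^ a.natDegree := by
  have hr : 1 < Fintype.card F := Fintype.one_lt_card
  have h : carlitzPoly a = (∑ j ∈ Finset.range a.natDegree, C (C (a.coeff j)) * carlitzIter F j) +
      carlitzIter F a.natDegree := by
    rw [carlitzPoly, sum_over_range _ (by simp), Finset.sum_range_succ, ha.coeff_natDegree]
    simp
  obtain ⟨hm, hd⟩ := carlitzIter_monic_natDegree (F := F) a.natDegree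
  have hlt : (∑ j ∈ Finset.range a.natDegree, C (C (a.coeff j)) * carlitzIter F j).degree <
      (carlitzIter F a.natDegree).degree := by
    rw [degree_eq_natDegree hm.ne_zero]
    refine (degree_sum_le _ _).trans_lt ((Finset.sup_lt_iff (WithBot.bot_lt_coe _)).2 fun j hj => ?_)
    rw [← smul_eq_C_mul]
    refine (degree_smul_le _ _).trans_lt ?_
    rw [degree_eq_natDegree (carlitzIter_monic_natDegree j).1.ne_zero,
      (carlitzIter_monic_natDegree j).2, hd]
    exact_mod_cast Nat.pow_lt_pow_right hr (Finset.mem_range.1 hj)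
  rw [h]
  exact ⟨hm.add_of_right hlt, by rw [natDegree_add_eq_right_of_degree_lt hlt, hd]⟩

/-- The `r`-th powers have zero derivative, so only the linear coefficient survives. This is the
source of separability of the torsion whenever `a` is nonzero in the field at hand. -/
theorem derivative_carlitzPoly (a : F[X]) : derivative (carlitzPoly a) = C a := by
  rw [carlitzPoly, Polynomial.sum, derivative_sum]
  simp only [derivative_mul, derivative_C, zero_mul, zero_add, derivative_carlitzIter, ← C_mul]
  rw [← map_sum]
  congr 1
  exact a.as_sum_support_C_mul_X_pow.symm

theorem carlitzPoly_coeff_zero (a : F[X]) : (carlitzPoly a).coeff 0 = 0 := by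
  simp [carlitzPoly, Polynomial.sum, carlitzIter_coeff_zero]

/-- This shape is used in two opposite situations. Where `a` vanishes, `0` becomes a multiple root;
where `a` is a unit of a valuation ring, no nonzero root lies in the maximal ideal. -/
theorem carlitzPoly_eq (a : F[X]) :
    carlitzPoly a = C a * X + X ^ 2 * (carlitzPoly a).divX.divX := by
  have h0 := carlitzPoly_coeff_zero a
  have h1 : (carlitzPoly a).coeff 1 = a := by
    have := congrArg (fun q => coeff q 0) (derivative_carlitzPoly a)
    simpa [coeff_derivative] using this
  have e1 := divX_mul_X_add (carlitzPoly a)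
  have e2 := divX_mul_X_add (carlitzPoly a).divX
  rw [h0, C_0, add_zero] at e1
  rw [coeff_divX, zero_add, h1] at e2
  calc carlitzPoly a = (carlitzPoly a).divX * X := e1.symm
    _ = ((carlitzPoly a).divX.divX * X + C a) * X := by rw [e2]
    _ = _ := by ring

end CarlitzPoly

namespace DrinfeldModule

variable {F L : Type*} [Field F] [Fintype F] [Field L] [Algebra F[X] L]

theorem psi_eq_map_carlitzPoly (ψ : DrinfeldModule F L)
    (h : ψ.psiT = C (algebraMap F[X] L X) * X + X ^ Fintype.card F) (a : F[X]) :
    ψ.psi a = (carlitzPoly a).map (algebraMap F[X] L) := by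
  have hi : ∀ j, (fun q : L[X] => ψ.psiT.comp q)^[j] X =
      (carlitzIter F j).map (algebraMap F[X] L) := by
    intro j
    induction j with
    | zero => simp [carlitzIter_zero]
    | succ j ih => rw [Function.iterate_succ_apply', ih, h, carlitzIter_succ]; simp
  rw [psi, carlitzPoly, Polynomial.sum, Polynomial.sum, Polynomial.map_sum]
  exact Finset.sum_congr rfl fun j _ => by simp [hi]

end DrinfeldModule

/-! ### The Carlitz module and its twists over extensions of `k`. -/

section BaseChange

variable {F M : Type*} [Field F] [Fintype F] [Field M] [Algebra F[X] M] [Algebra (RatFunc F) M]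
  [IsScalarTower F[X] (RatFunc F) M]

theorem carlitzTwist_psiT (β : RatFunc F) (hβ : β ≠ 0) :
    ((carlitzTwist β hβ).baseChange M).psiT =
      C (algebraMap F[X] M X) * X + C (algebraMap (RatFunc F) M β) * X ^ Fintype.card F := by
  have h : ((carlitzTwist β hβ).baseChange M).psiT = ∑ i : Fin 2,
      C (algebraMap (RatFunc F) M ((![algebraMap F[X] (RatFunc F) X, β] : Fin 2 → RatFunc F) i)) *
        X ^ (Fintype.card F ^ (i : ℕ)) := rfl
  rw [h, Fin.sum_univ_two, IsScalarTower.algebraMap_apply F[X] (RatFunc F) M]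
  simp

theorem carlitz_psiT : ((carlitz F).baseChange M).psiT =
    C (algebraMap F[X] M X) * X + X ^ Fintype.card F := by
  rw [carlitz, carlitzTwist_psiT]; simp

theorem carlitz_psi (a : F[X]) :
    ((carlitz F).baseChange M).psi a = (carlitzPoly a).map (algebraMap F[X] M) :=
  DrinfeldModule.psi_eq_map_carlitzPoly _ carlitz_psiT a

theorem carlitzTwist_psi {β : RatFunc F} (hβ : β ≠ 0) {α : M}
    (h : algebraMap (RatFunc F) M β = α ^ (Fintype.card F - 1)) (a : F[X]) :
    ((carlitzTwist β hβ).baseChange M).psi a =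
      (C α⁻¹ * X).comp ((((carlitz F).baseChange M).psi a).comp (C α * X)) := by
  have hr : 1 < Fintype.card F := Fintype.one_lt_card
  have hα : α ≠ 0 := by
    rintro rfl
    rw [zero_pow (by omega)] at h
    exact hβ ((map_eq_zero _).1 h)
  have hc : (C α⁻¹ * C α : M[X]) = 1 := by rw [← C_mul, inv_mul_cancel₀ hα, C_1]
  -- The leading coefficient has the form `α⁻¹ α^r`, exactly what conjugating `x^r` by `α` produces.
  have hb : (C (α ^ (Fintype.card F - 1)) : M[X]) = C α⁻¹ * C α ^ Fintype.card F := by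
    rw [← C_pow, ← C_mul]
    congr 1
    obtain ⟨m, hm⟩ : ∃ m, Fintype.card F = m + 1 := ⟨_, (Nat.sub_add_cancel hr.le).symm⟩
    rw [hm, Nat.add_sub_cancel, pow_succ']
    field_simp
  have hi : ∀ j, (fun q : M[X] => ((carlitzTwist β hβ).baseChange M).psiT.comp q)^[j] X =
      C α⁻¹ * ((fun q : M[X] => ((carlitz F).baseChange M).psiT.comp q)^[j] X).comp (C α * X) := by
    intro j
    induction j with
    | zero => simp [← mul_assoc, hc]
    | succ j ih =>
      rw [Function.iterate_succ_apply', Function.iterate_succ_apply', ih, carlitzTwist_psiT,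
        carlitz_psiT, h, hb]
      generalize (fun q : M[X] => (C (algebraMap F[X] M X) * X + X ^ Fintype.card F).comp q)^[j]
        X = w at *
      simp only [add_comp, mul_comp, C_comp, X_comp, pow_comp]
      rw [mul_pow]
      have : (C α⁻¹ * C α ^ Fintype.card F * (C α⁻¹ ^ Fintype.card F * w.comp (C α * X) ^
          Fintype.card F) : M[X]) = C α⁻¹ * (w.comp (C α * X)) ^ Fintype.card F := by
        rw [mul_assoc (C α⁻¹), ← mul_assoc (C α ^ _), ← mul_pow, mul_comm (C α), hc, one_pow,
          one_mul]
      rw [this]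
      ring
  rw [DrinfeldModule.psi, DrinfeldModule.psi, Polynomial.sum, Polynomial.sum, mul_comp, C_comp,
    X_comp, sum_comp, Finset.mul_sum]
  refine Finset.sum_congr rfl fun j _ => ?_
  rw [hi, mul_comp, C_comp]
  ring

end BaseChange

/-! ### Cyclic submodules of `𝔽_r[T]`-modules -/

section Cyclic

variable {F : Type*} [Field F] {E : Type*} [AddCommGroup E] [Module F[X] E]

/-- The annihilator of `x` is principal. Its generator divides `g^(n+1)` but not `g^n`, hence is
associated to `g^(n+1)`. -/
theorem pow_dvd_of_smul_eq_zero {g : F[X]} (hg : Irreducible g) {n : ℕ} {x : E}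
    (hx : g ^ (n + 1) • x = 0) (hx' : g ^ n • x ≠ 0) {b : F[X]} (hb : b • x = 0) :
    g ^ (n + 1) ∣ b := by
  have hmem : ∀ c : F[X], c ∈ Ideal.torsionOf F[X] E x ↔ c • x = 0 :=
    fun c => Ideal.mem_torsionOf_iff _ _
  have hc : ∀ c : F[X], c • x = 0 ↔ Submodule.IsPrincipal.generator (Ideal.torsionOf F[X] E x) ∣ c :=
    fun c => by rw [← hmem, Submodule.IsPrincipal.mem_iff_generator_dvd]
  obtain ⟨i, hi, hass⟩ := (dvd_prime_pow hg.prime (n + 1)).1 ((hc _).1 hx)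
  rcases Nat.lt_or_ge n i with h | h
  · have : i = n + 1 := le_antisymm hi h
    subst this
    exact hass.symm.dvd.trans ((hc b).1 hb)
  · exact absurd ((hc _).2 (hass.dvd.trans (pow_dvd_pow g h))) hx'

/-- The polynomials of degree less than `deg P` act on `x` with distinct results. This is the lower
bound in both counting arguments below. -/
theorem exists_finset_smul [Fintype F] [DecidableEq E] {P : F[X]} (hP : P ≠ 0) {x : E}
    (h : ∀ b : F[X], b • x = 0 → P ∣ b) :
    ∃ t : Finset E, t.card = Fintype.card F ^ P.natDegree ∧ ∀ y ∈ t, ∃ b : F[X], b • x = y := by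
  let φ : (Fin P.natDegree → F) → E := fun c => ((degreeLTEquiv F P.natDegree).symm c : F[X]) • x
  have hφ : Function.Injective φ := by
    intro c d hcd
    have h1 : (((degreeLTEquiv F P.natDegree).symm (c - d) : degreeLT F P.natDegree) : F[X]) • x =
        0 := by
      rw [map_sub, Submodule.coe_sub, sub_smul]
      exact sub_eq_zero.2 hcd
    have h2 := mem_degreeLT.1 ((degreeLTEquiv F P.natDegree).symm (c - d)).2
    rw [← degree_eq_natDegree hP] at h2
    have h3 := eq_zero_of_dvd_of_degree_lt (h _ h1) h2
    rw [ZeroMemClass.coe_eq_zero, LinearEquiv.map_eq_zero_iff, sub_eq_zero] at h3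
    exact h3
  refine ⟨Finset.univ.image φ, ?_, ?_⟩
  · rw [Finset.card_image_of_injective _ hφ]
    simp
  · intro y hy
    obtain ⟨c, -, hc⟩ := Finset.mem_image.1 hy
    exact ⟨_, hc⟩

end Cyclic

/-! ### Reduction of the Carlitz module at a prime -/

section Reduction

variable {F : Type*} [Field F] [Fintype F]

/-- The Carlitz module over an arbitrary `𝔽_r[T]`-field. -/
def carlitzOver (F L : Type*) [Field F] [Field L] [Algebra F[X] L] : DrinfeldModule F L where
  rank := 1
  rank_pos := one_pos
  coeff := ![algebraMap F[X] L X, 1]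
  coeff_zero := rfl
  coeff_rank := one_ne_zero

theorem carlitzOver_psi {L : Type*} [Field L] [Algebra F[X] L] (a : F[X]) :
    (carlitzOver F L).psi a = (carlitzPoly a).map (algebraMap F[X] L) := by
  refine DrinfeldModule.psi_eq_map_carlitzPoly _ ?_ a
  have h : (carlitzOver F L).psiT = ∑ i : Fin 2,
      C ((![algebraMap F[X] L X, 1] : Fin 2 → L) i) * X ^ (Fintype.card F ^ (i : ℕ)) := rfl
  rw [h, Fin.sum_univ_two]
  simp

/-- In characteristic `f` the reduction is supersingular, by counting. A nonzero root would generate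
a module with `r^{deg f}` elements, all of them roots of a polynomial of that degree, so every root
would be simple. But the linear coefficient `f` vanishes in `κ`, so `0` is a double root. -/
theorem carlitzPoly_map_eq_X_pow {κ : Type*} [Field κ] [Algebra F[X] κ] [Algebra F κ]
    [IsScalarTower F F[X] κ] [IsAlgClosed κ] {f : F[X]} (hm : f.Monic) (hf : Irreducible f)
    (hκ : algebraMap F[X] κ f = 0) :
    (carlitzPoly f).map (algebraMap F[X] κ) = X ^ Fintype.card F ^ f.natDegree := by
  classical
  obtain ⟨hmon, hdeg⟩ := carlitzPoly_monic_natDegree hm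
  set P := (carlitzPoly f).map (algebraMap F[X] κ) with hP
  have hPm : P.Monic := hmon.map _
  have hPd : P.natDegree = Fintype.card F ^ f.natDegree := by rw [hP, hmon.natDegree_map, hdeg]
  have hsq : P = X ^ 2 * (carlitzPoly f).divX.divX.map (algebraMap F[X] κ) := by
    rw [hP]
    conv_lhs => rw [carlitzPoly_eq]
    simp [hκ]
  have hroot : ∀ x : κ, P.eval x = 0 → x = 0 := by
    intro x hx
    by_contra hx0
    have hsm : ∀ a : F[X], a • (Module.AEval'.of (carlitzOver F κ).psiEnd x) =
        Module.AEval'.of (carlitzOver F κ).psiEnd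
          (((carlitzPoly a).map (algebraMap F[X] κ)).eval x) := by
      intro a
      rw [DrinfeldModule.smul_point, carlitzOver_psi]
    have hz : f • (Module.AEval'.of (carlitzOver F κ).psiEnd x) = 0 := by
      rw [hsm, ← hP, hx, map_zero]
    obtain ⟨t, ht, hts⟩ := exists_finset_smul (P := f) hf.ne_zero
      (x := Module.AEval'.of (carlitzOver F κ).psiEnd x) fun b hb => by
        have := pow_dvd_of_smul_eq_zero hf (n := 0) (by simpa using hz)
          (by simpa using hx0) hb
        simpa using this
    have hsub : t.image (Module.AEval'.of (carlitzOver F κ).psiEnd).symm ⊆ P.roots.toFinset := by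
      intro y hy
      obtain ⟨z, hzt, rfl⟩ := Finset.mem_image.1 hy
      obtain ⟨b, rfl⟩ := hts z hzt
      rw [Multiset.mem_toFinset, mem_roots hPm.ne_zero, IsRoot.def]
      have h1 : f • (b • (Module.AEval'.of (carlitzOver F κ).psiEnd x)) = 0 := by
        rw [smul_comm, hz, smul_zero]
      generalize b • (Module.AEval'.of (carlitzOver F κ).psiEnd x) = w at h1
      obtain ⟨w, rfl⟩ := (Module.AEval'.of (carlitzOver F κ).psiEnd).surjective w
      rw [DrinfeldModule.smul_point, carlitzOver_psi] at h1
      rw [LinearEquiv.symm_apply_apply]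
      exact (LinearEquiv.map_eq_zero_iff _).1 h1
    have hcard := Finset.card_le_card hsub
    rw [Finset.card_image_of_injective _ (LinearEquiv.injective _), ht, ← hPd] at hcard
    have hnodup : P.roots.Nodup := by
      rw [← Multiset.toFinset_card_eq_card_iff_nodup]
      exact le_antisymm (Multiset.toFinset_card_le _) ((card_roots' P).trans hcard)
    have h2 : 2 ≤ P.roots.count 0 := by
      rw [count_roots, le_rootMultiplicity_iff hPm.ne_zero, C_0, sub_zero]
      exact ⟨_, hsq⟩
    have := Multiset.nodup_iff_count_le_one.1 hnodup 0
    omega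
  have hs : P.Splits := IsAlgClosed.splits P
  have hr : P.roots = Multiset.replicate P.natDegree 0 := by
    rw [Multiset.eq_replicate]
    refine ⟨hs.natDegree_eq_card_roots.symm, fun x hx => hroot x ?_⟩
    exact (mem_roots hPm.ne_zero).1 hx
  have := hs.eq_prod_roots_of_monic hPm
  rw [hr] at this
  rw [this, ← hPd]
  simp

/-- The congruence may be tested on coefficients in an algebraic closure of `A/(f)`, where the
preceding theorem applies. It links the action of `f` to the Frobenius at `f`. -/
theorem exists_carlitzPoly_eq_X_pow_add {f : F[X]} (hm : f.Monic) (hf : Irreducible f) :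
    ∃ Q : F[X][X], carlitzPoly f = X ^ Fintype.card F ^ f.natDegree + C f * Q := by
  have : Fact (Irreducible f) := ⟨hf⟩
  let κ := AlgebraicClosure (AdjoinRoot f)
  let : Algebra F[X] κ :=
    ((algebraMap (AdjoinRoot f) κ).comp (AdjoinRoot.mk f)).toAlgebra
  have : IsScalarTower F F[X] κ := IsScalarTower.of_algebraMap_eq fun c => rfl
  have hker : ∀ a : F[X], algebraMap F[X] κ a = 0 ↔ f ∣ a := by
    intro a
    rw [← AdjoinRoot.mk_eq_zero]
    exact map_eq_zero (algebraMap (AdjoinRoot f) κ)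
  have h := carlitzPoly_map_eq_X_pow (κ := κ) hm hf ((hker f).2 dvd_rfl)
  have h2 : C f ∣ carlitzPoly f - X ^ Fintype.card F ^ f.natDegree := by
    rw [C_dvd_iff_dvd_coeff]
    intro i
    rw [← hker, ← coeff_map, Polynomial.map_sub, h]
    simp
  obtain ⟨Q, hQ⟩ := h2
  exact ⟨Q, by rw [← hQ]; ring⟩

end Reduction

/-! ### Places of `k^sep` -/

section ValuationSubring

variable {K L : Type*} [Field K] [Field L]

theorem ValuationSubring.algebraMap_mem_nonunits_iff [Algebra K L] {Γ : Type*}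
    [LinearOrderedCommGroupWithZero Γ] {v : Valuation K Γ} {B : ValuationSubring L}
    (hB : B.comap (algebraMap K L) = v.valuationSubring) (x : K) :
    algebraMap K L x ∈ B.nonunits ↔ v x < 1 := by
  rw [ValuationSubring.mem_nonunits_iff_or, ← map_inv₀, ← ValuationSubring.mem_comap, hB,
    Valuation.mem_valuationSubring_iff, map_inv₀, map_eq_zero]
  rcases eq_or_ne x 0 with rfl | hx
  · simp
  · have hv : 0 < v x := zero_lt_iff.2 ((v.ne_zero_iff).2 hx)
    simp [hx, inv_le_one₀ hv]

theorem ValuationSubring.algebraMap_mem_iff [Algebra K L] {Γ : Type*}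
    [LinearOrderedCommGroupWithZero Γ] {v : Valuation K Γ} {B : ValuationSubring L}
    (hB : B.comap (algebraMap K L) = v.valuationSubring) (x : K) :
    algebraMap K L x ∈ B ↔ v x ≤ 1 := by
  rw [← ValuationSubring.mem_comap, hB, Valuation.mem_valuationSubring_iff]

variable (B : ValuationSubring L)

theorem ValuationSubring.nonunits_add {x y : L} (hx : x ∈ B.nonunits) (hy : y ∈ B.nonunits) :
    x + y ∈ B.nonunits := by
  rw [B.mem_nonunits_iff] at *
  exact (B.valuation.map_add x y).trans_lt (max_lt hx hy)

theorem ValuationSubring.nonunits_neg {x : L} (hx : x ∈ B.nonunits) : -x ∈ B.nonunits := by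
  rw [B.mem_nonunits_iff] at *
  rwa [Valuation.map_neg]

theorem ValuationSubring.nonunits_sub {x y : L} (hx : x ∈ B.nonunits) (hy : y ∈ B.nonunits) :
    x - y ∈ B.nonunits := by
  rw [sub_eq_add_neg]
  exact B.nonunits_add hx (B.nonunits_neg hy)

theorem ValuationSubring.nonunits_mul {x y : L} (hx : x ∈ B.nonunits) (hy : y ∈ B) :
    x * y ∈ B.nonunits := by
  rw [B.mem_nonunits_iff] at *
  rw [map_mul]
  exact mul_lt_one_of_lt_of_le hx ((B.valuation_le_one_iff y).2 hy)

theorem ValuationSubring.one_notMem_nonunits : (1 : L) ∉ B.nonunits := by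
  simp [B.mem_nonunits_iff]

variable [Algebra K L]
open scoped Pointwise

theorem ValuationSubring.apply_mem_iff {σ : L ≃ₐ[K] L} (hσ : σ ∈ B.decompositionSubgroup K) {x : L} :
    σ x ∈ B ↔ x ∈ B := by
  have h : σ • B = B := hσ
  constructor
  · intro hx
    rw [← h] at hx
    exact ValuationSubring.smul_mem_pointwise_smul_iff.1 hx
  · intro hx
    rw [← h]
    exact ValuationSubring.smul_mem_pointwise_smul _ _ _ hx

theorem ValuationSubring.apply_mem_nonunits_iff {σ : L ≃ₐ[K] L}
    (hσ : σ ∈ B.decompositionSubgroup K) {x : L} : σ x ∈ B.nonunits ↔ x ∈ B.nonunits := by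
  rw [B.mem_nonunits_iff_or, B.mem_nonunits_iff_or, ← map_inv₀, B.apply_mem_iff hσ]
  simp

theorem ValuationSubring.mem_inertiaSubgroup_iff (τ : B.decompositionSubgroup K) :
    τ ∈ B.inertiaSubgroup K ↔ ∀ x ∈ B, (τ : L ≃ₐ[K] L) x - x ∈ B.nonunits := by
  have key : ∀ x : B, (τ : L ≃ₐ[K] L) x - x ∈ B.nonunits ↔
      IsLocalRing.residue B (τ • x) = IsLocalRing.residue B x := by
    intro x
    rw [← sub_eq_zero, ← map_sub, IsLocalRing.residue_eq_zero_iff,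
      ← ValuationSubring.coe_mem_nonunits_iff]
    rfl
  rw [ValuationSubring.inertiaSubgroup, MonoidHom.mem_ker]
  constructor
  · intro h x hx
    rw [key ⟨x, hx⟩]
    exact DFunLike.congr_fun h (IsLocalRing.residue B ⟨x, hx⟩)
  · intro h
    ext y
    obtain ⟨x, rfl⟩ := IsLocalRing.residue_surjective y
    exact (key x).1 (h x x.2)

theorem ValuationSubring.smul_mem_nonunits_iff (σ : L ≃ₐ[K] L) {x : L} :
    x ∈ (σ • B).nonunits ↔ σ⁻¹ x ∈ B.nonunits := by
  rw [ValuationSubring.mem_nonunits_iff_or, ValuationSubring.mem_nonunits_iff_or,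
    ValuationSubring.mem_pointwise_smul_iff_inv_smul_mem]
  change x = 0 ∨ σ⁻¹ x⁻¹ ∉ B ↔ _
  rw [map_inv₀]
  simp

end ValuationSubring

/-! ### Conjugacy of valuation rings with the same centre in the base ring. -/

section Conjugacy

variable {L : Type*} [Field L]
variable {A : Type*} [CommRing A] [Algebra A L]

/-- The integral closure is the intersection of the valuation rings containing `A`. -/
theorem mem_integralClosure_of_forall_valuationSubring {x : L}
    (h : ∀ V : ValuationSubring L, (∀ a : A, algebraMap A L a ∈ V) → x ∈ V) :
    x ∈ integralClosure A L := by
  by_contra hx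
  have : IsIntegrallyClosedIn (integralClosure A L).toSubring L :=
    inferInstanceAs (IsIntegrallyClosedIn (integralClosure A L) L)
  obtain ⟨V, hV, hxV⟩ := Subring.exists_le_valuationSubring_of_isIntegrallyClosedIn
    (R := (integralClosure A L).toSubring) hx
  exact hxV (h V fun a => hV (Subalgebra.algebraMap_mem _ a))

/-- Write `c_m = q_m + q_{m+1} x + ...`, so that `x c_{m+1} = c_m - q_m` and `c_0 = 0`. If `x ∈ V`
the claim is clear; otherwise `x⁻¹ ∈ V`, and induction through `c_m = x⁻¹ (x c_m)` works. With the
preceding theorem, `c_m` and `x c_m` are integral, so `x` is a quotient of integral elements in many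
ways. -/
theorem mul_aeval_divX_mem {V : ValuationSubring L} (hV : ∀ a : A, algebraMap A L a ∈ V) {x : L}
    {q : A[X]} (hq : aeval x q = 0) (m : ℕ) : aeval x (divX^[m] q) ∈ V ∧
      x * aeval x (divX^[m] q) ∈ V := by
  by_cases hx : x ∈ V
  · have h : aeval x (divX^[m] q) ∈ V := by
      rw [aeval_eq_sum_range]
      refine sum_mem fun i _ => ?_
      rw [Algebra.smul_def]
      exact mul_mem (hV _) (pow_mem hx i)
    exact ⟨h, mul_mem hx h⟩
  · have hx' : x⁻¹ ∈ V := (V.mem_or_inv_mem x).resolve_left hx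
    have hx0 : x ≠ 0 := by
      rintro rfl
      exact hx (zero_mem _)
    have h : x * aeval x (divX^[m] q) ∈ V := by
      induction m with
      | zero => simp [hq]
      | succ m ih =>
        rw [Function.iterate_succ_apply']
        have e := congrArg (aeval x) (divX_mul_X_add (divX^[m] q))
        rw [map_add, map_mul, aeval_X, aeval_C] at e
        have h2 : x * aeval x (divX^[m] q).divX =
            x⁻¹ * (x * aeval x (divX^[m] q)) - algebraMap A L ((divX^[m] q).coeff 0) := by
          rw [inv_mul_cancel_left₀ hx0, ← e]
          ring
        rw [h2]
        exact sub_mem (mul_mem hx' ih) (hV _)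
    refine ⟨?_, h⟩
    have := mul_mem hx' h
    rwa [inv_mul_cancel_left₀ hx0] at this

theorem coeff_zero_iterate_divX (q : A[X]) (m : ℕ) : (divX^[m] q).coeff 0 = q.coeff m := by
  suffices h : ∀ (m n : ℕ), (divX^[m] q).coeff n = q.coeff (n + m) by simpa using h m 0
  intro m
  induction m with
  | zero => intro n; rfl
  | succ m ih => intro n; rw [Function.iterate_succ_apply', coeff_divX, ih]; congr 1; ring

theorem ValuationSubring.mem_of_mem_integralClosure {B : ValuationSubring L}
    (hB : ∀ a : A, algebraMap A L a ∈ B) {s : L} (hs : s ∈ integralClosure A L) : s ∈ B := by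
  let φ : A →+* B := (algebraMap A L).codRestrict B hB
  have h1 : IsIntegral B s := IsIntegral.map_of_comp_eq φ (RingHom.id L) (by ext; rfl) hs
  obtain ⟨y, rfl⟩ := IsIntegrallyClosed.isIntegral_iff.1 h1
  exact y.2

/-- Over an element `x` algebraic over the fraction field of `A`, a valuation ring containing `A`
is determined by its centre on the integral closure. -/
theorem ValuationSubring.le_of_center_eq {B B' : ValuationSubring L}
    (hB' : ∀ a : A, algebraMap A L a ∈ B')
    (hc : ∀ s ∈ integralClosure A L, s ∈ B.nonunits ↔ s ∈ B'.nonunits)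
    (hp : ∀ x : L, ∃ q : A[X], aeval x q = 0 ∧ ∃ m, algebraMap A L (q.coeff m) ∉ B.nonunits) :
    B ≤ B' := by
  intro x hx
  obtain ⟨q, hq, m, hm⟩ := hp x
  have hS : ∀ m, aeval x (divX^[m] q) ∈ integralClosure A L ∧
      x * aeval x (divX^[m] q) ∈ integralClosure A L := fun m =>
    ⟨mem_integralClosure_of_forall_valuationSubring fun V hV => (mul_aeval_divX_mem hV hq m).1,
      mem_integralClosure_of_forall_valuationSubring fun V hV => (mul_aeval_divX_mem hV hq m).2⟩
  -- If all `c_m` were in the maximal ideal of `B`, so would be every coefficient `q_m = c_m -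
  -- c_{m+1} x`, because `x ∈ B`. For the `m` found here, `x = (x c_m) / c_m` has a denominator that
  -- is a unit of `B'` by equality of the centres.
  have key : ∃ m, aeval x (divX^[m] q) ∉ B.nonunits := by
    by_contra! hall
    apply hm
    have e := congrArg (aeval x) (divX_mul_X_add (divX^[m] q))
    rw [map_add, map_mul, aeval_X, aeval_C, coeff_zero_iterate_divX,
      ← Function.iterate_succ_apply' divX] at e
    have e2 : algebraMap A L (q.coeff m) =
        aeval x (divX^[m] q) - aeval x (divX^[m+1] q) * x := by rw [← e]; ring
    rw [e2]
    exact B.nonunits_sub (hall m) (B.nonunits_mul (hall _) hx)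
  obtain ⟨m, hm⟩ := key
  rw [hc _ (hS m).1] at hm
  have h1 := ValuationSubring.mem_of_mem_integralClosure hB' (hS m).2
  generalize aeval x (divX^[m] q) = c at *
  have hc0 : c ≠ 0 := by
    rintro rfl
    exact hm (by simp [B'.mem_nonunits_iff])
  have hcinv : c⁻¹ ∈ B' := by
    rw [B'.mem_nonunits_iff_or] at hm
    push Not at hm
    exact hm.2
  have := B'.mul_mem _ _ h1 hcinv
  rwa [mul_inv_cancel_right₀ hc0] at this

open scoped Pointwise

/-- The Galois group is transitive on the primes of the integral closure over a given prime of `A`,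
and a valuation ring is recovered from its centre there. The hypothesis `hp` provides the algebraic
equations needed for the recovery. -/
theorem ValuationSubring.exists_smul_eq {K : Type*} [Field K] [Algebra K L] [Algebra A K]
    [IsDomain A] [IsFractionRing A K] [IsScalarTower A K L] [IsIntegrallyClosed A] [IsGalois K L]
    {B B' : ValuationSubring L}
    (hB : ∀ a : A, algebraMap A L a ∈ B) (hB' : ∀ a : A, algebraMap A L a ∈ B')
    (hc : ∀ a : A, algebraMap A L a ∈ B.nonunits ↔ algebraMap A L a ∈ B'.nonunits)
    (hp : ∀ x : L, ∃ q : A[X], aeval x q = 0 ∧ ∃ m, algebraMap A L (q.coeff m) ∉ B.nonunits) :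
    ∃ σ : L ≃ₐ[K] L, σ • B = B' := by
  let S := integralClosure A L
  have hact : ∀ (σ : L ≃ₐ[K] L) (s : S), ((σ • s : S) : L) = σ s := fun _ _ => rfl
  have : SMulCommClass (L ≃ₐ[K] L) A S := ⟨fun σ a s => by
    apply Subtype.ext
    rw [hact, Subalgebra.coe_smul, Subalgebra.coe_smul, hact, Algebra.smul_def, Algebra.smul_def,
      map_mul, IsScalarTower.algebraMap_apply A K L, AlgEquiv.commutes]⟩
  -- A Galois-invariant integral element lies in `K`, hence in the integrally closed ring `A`.
  have : Algebra.IsInvariant A S (L ≃ₐ[K] L) := ⟨fun s hs => by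
    have h1 : (s : L) ∈ (⊥ : IntermediateField K L) :=
      (InfiniteGalois.mem_bot_iff_fixed (s : L)).2 fun σ => by rw [← hact, hs]
    obtain ⟨k, hk⟩ := IntermediateField.mem_bot.1 h1
    have h2 : IsIntegral A (algebraMap K L k) := by rw [hk]; exact s.2
    rw [isIntegral_algebraMap_iff (algebraMap K L).injective] at h2
    obtain ⟨a, ha⟩ := IsIntegrallyClosed.isIntegral_iff.1 h2
    refine ⟨a, Subtype.ext ?_⟩
    rw [← hk, ← ha, ← IsScalarTower.algebraMap_apply]
    rfl⟩
  -- Transitivity for a profinite group needs a continuous action on the discrete ring `S`;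
  -- stabilizers are open because elements of `S` are algebraic over `K`.
  let : TopologicalSpace S := ⊥
  have : DiscreteTopology S := ⟨rfl⟩
  have hcont : ContinuousSMul (L ≃ₐ[K] L) S :=
    (continuousSMul_iff_stabilizer_isOpen (X := S)).2 fun s => by
      convert stabilizer_isOpen_of_isIntegral (K := K) (s : L) using 1
      ext σ
      simp only [SetLike.mem_coe, MulAction.mem_stabilizer_iff, Subtype.ext_iff]
      rfl
  have hV : ∀ {V : ValuationSubring L}, (∀ a : A, algebraMap A L a ∈ V) → ∀ s : S, (s : L) ∈ V :=
    fun hV s => ValuationSubring.mem_of_mem_integralClosure hV s.2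
  have hcenter : ∀ V : ValuationSubring L, (∀ a : A, algebraMap A L a ∈ V) →
      ∃ P : Ideal S, P.IsPrime ∧ ∀ s : S, s ∈ P ↔ (s : L) ∈ V.nonunits := fun V h =>
    ⟨(IsLocalRing.maximalIdeal V).comap ((algebraMap S L).codRestrict V (hV h)),
      Ideal.comap_isPrime _ _, fun s => by
        rw [Ideal.mem_comap, ← ValuationSubring.coe_mem_nonunits_iff]
        rfl⟩
  obtain ⟨P, hprime, hP⟩ := hcenter B hB
  obtain ⟨P', hprime', hP'⟩ := hcenter B' hB'
  have hunder : P.under A = P'.under A := by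
    ext a
    rw [Ideal.under_def, Ideal.under_def, Ideal.mem_comap, Ideal.mem_comap, hP, hP']
    exact hc a
  obtain ⟨σ, hσ⟩ := Algebra.IsInvariant.exists_smul_of_under_eq_of_profinite
    (A := A) (G := L ≃ₐ[K] L) P P' hunder
  have hσB : ∀ a : A, algebraMap A L a ∈ σ • B := fun a => by
    rw [ValuationSubring.mem_pointwise_smul_iff_inv_smul_mem]
    change σ⁻¹ _ ∈ B
    rw [IsScalarTower.algebraMap_apply A K L, AlgEquiv.commutes, ← IsScalarTower.algebraMap_apply]
    exact hB a
  have hcent : ∀ s ∈ integralClosure A L, s ∈ (σ • B).nonunits ↔ s ∈ B'.nonunits := by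
    intro s hs
    have h1 := hP' ⟨s, hs⟩
    rw [hσ, Ideal.mem_pointwise_smul_iff_inv_smul_mem, hP, hact] at h1
    rw [ValuationSubring.smul_mem_nonunits_iff]
    exact h1
  have hpσ : ∀ x : L, ∃ q : A[X], aeval x q = 0 ∧
      ∃ m, algebraMap A L (q.coeff m) ∉ (σ • B).nonunits := fun x => by
    obtain ⟨q, h1, m, h2⟩ := hp x
    refine ⟨q, h1, m, ?_⟩
    rw [hcent _ (Subalgebra.algebraMap_mem _ _), ← hc]
    exact h2
  refine ⟨σ, le_antisymm (ValuationSubring.le_of_center_eq hB' hcent hpσ)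
    (ValuationSubring.le_of_center_eq hσB (fun s hs => (hcent s hs).symm) fun x => ?_)⟩
  obtain ⟨q, h1, m, h2⟩ := hp x
  exact ⟨q, h1, m, by rwa [← hc]⟩

end Conjugacy

/-! ### Places of `k^sep` over a finite prime are conjugate. -/

section PlacesOverPrime

variable {F : Type*} [Field F]

theorem kSep_algebraMap_mem_nonunits_iff {B : ValuationSubring (kSep F)} {f : MonicPrime F}
    (hB : LiesOverPrime B f) (a : F[X]) : algebraMap F[X] (kSep F) a ∈ B.nonunits ↔ f.1 ∣ a := by
  rw [IsScalarTower.algebraMap_apply F[X] (RatFunc F) (kSep F),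
    ValuationSubring.algebraMap_mem_nonunits_iff hB,
    IsDedekindDomain.HeightOneSpectrum.valuation_lt_one_iff_mem]
  exact Ideal.mem_span_singleton

theorem kSep_algebraMap_mem {B : ValuationSubring (kSep F)} {f : MonicPrime F}
    (hB : LiesOverPrime B f) (a : F[X]) : algebraMap F[X] (kSep F) a ∈ B := by
  rw [IsScalarTower.algebraMap_apply F[X] (RatFunc F) (kSep F),
    ValuationSubring.algebraMap_mem_iff hB]
  exact IsDedekindDomain.HeightOneSpectrum.valuation_le_one _ _

/-- Any nonzero algebraic equation over `A` may be replaced by its primitive part. -/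
theorem exists_aeval_eq_zero_and_not_dvd (f : MonicPrime F) (x : kSep F) :
    ∃ q : F[X][X], aeval x q = 0 ∧ ∃ m, ¬ f.1 ∣ q.coeff m := by
  have hx : IsAlgebraic F[X] x :=
    (IsFractionRing.isAlgebraic_iff F[X] (RatFunc F) (kSep F)).2 (Algebra.IsAlgebraic.isAlgebraic x)
  obtain ⟨q, hq0, hq⟩ := hx
  let : NormalizedGCDMonoid F[X] := Classical.choice inferInstance
  have : Module.IsTorsionFree F[X] (kSep F) := .trans_faithfulSMul F[X] (RatFunc F) (kSep F)
  refine ⟨q.primPart, aeval_primPart_eq_zero hq0 hq, ?_⟩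
  by_contra! h
  exact f.2.2.not_isUnit (q.isPrimitive_primPart _ ((C_dvd_iff_dvd_coeff _ _).2 h))

open scoped Pointwise

theorem exists_smul_eq_of_liesOverPrime {B B' : ValuationSubring (kSep F)} {f : MonicPrime F}
    (hB : LiesOverPrime B f) (hB' : LiesOverPrime B' f) : ∃ σ : GalK F, σ • B = B' := by
  refine ValuationSubring.exists_smul_eq (K := RatFunc F) (A := F[X]) (kSep_algebraMap_mem hB)
    (kSep_algebraMap_mem hB') (fun a => ?_) fun x => ?_
  · rw [kSep_algebraMap_mem_nonunits_iff hB, kSep_algebraMap_mem_nonunits_iff hB']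
  · obtain ⟨q, h1, m, h2⟩ := exists_aeval_eq_zero_and_not_dvd f x
    exact ⟨q, h1, m, by rwa [kSep_algebraMap_mem_nonunits_iff hB]⟩

end PlacesOverPrime

/-! ### Fields with a discrete valuation -/

section Valued

open Filter Topology WithZero

variable {K : Type*} [Field K] [hK : Valued K (WithZero (Multiplicative ℤ))]

theorem Valued.nonarchimedeanAddGroup : NonarchimedeanAddGroup K where
  is_nonarchimedean U hU := by
    obtain ⟨γ, hγ⟩ := Valued.mem_nhds_zero.1 hU
    exact ⟨⟨Valuation.ltAddSubgroup Valued.v.restrict γ, Valued.isOpen_ball K γ.1⟩, hγ⟩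

theorem Valued.tendsto_zero_of_le {ι : Type*} {l : Filter ι} {f : ι → K} {n : ι → ℕ}
    (hn : Tendsto n l atTop) (hf : ∀ i, Valued.v (f i) ≤ exp (-(n i : ℤ))) :
    Tendsto f l (𝓝 0) := by
  intro U hU
  obtain ⟨γ, hγ⟩ := Valued.mem_nhds_zero.1 hU
  obtain ⟨N, hN⟩ : ∃ N : ℕ, exp (-(N : ℤ)) <
      MonoidWithZeroHom.ValueGroup₀.embedding (f := (.ofClass hK.v)) γ.1 := by
    have h0 : MonoidWithZeroHom.ValueGroup₀.embedding (f := (.ofClass hK.v)) γ.1 ≠ 0 := by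
      simp
    generalize MonoidWithZeroHom.ValueGroup₀.embedding (f := (.ofClass hK.v)) γ.1 = c at h0
    refine ⟨(1 - log c).toNat, ?_⟩
    rw [← exp_log h0, exp_lt_exp, log_exp]
    have := Int.self_le_toNat (1 - log c)
    omega
  change ∀ᶠ i in l, f i ∈ U
  filter_upwards [hn.eventually_ge_atTop N] with i hi
  refine hγ ?_
  change Valued.v.restrict (f i) < γ.1
  rw [Valuation.restrict_lt_iff_lt_embedding]
  refine (hf i).trans_lt (lt_of_le_of_lt ?_ hN)
  rw [exp_le_exp]
  omega

theorem Valued.isClosed_setOf_le (c : K) : IsClosed {x : K | Valued.v x ≤ Valued.v c} := by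
  have hs : {x : K | Valued.v x ≤ Valued.v c} = {x : K | Valued.v.restrict x ≤ Valued.v.restrict c} :=
    Set.ext fun z => by
      change Valued.v z ≤ _ ↔ Valued.v.restrict z ≤ Valued.v.restrict c
      rw [Valuation.restrict_le_iff]
  rw [hs]
  exact Valued.isClosed_closedBall _ _

theorem Valued.isOpen_setOf_le {c : K} (hc : c ≠ 0) : IsOpen {x : K | Valued.v x ≤ Valued.v c} := by
  have hs : {x : K | Valued.v x ≤ Valued.v c} = {x : K | Valued.v.restrict x ≤ Valued.v.restrict c} :=
    Set.ext fun z => by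
      change Valued.v z ≤ _ ↔ Valued.v.restrict z ≤ Valued.v.restrict c
      rw [Valuation.restrict_le_iff]
  rw [hs]
  exact Valued.isOpen_closedBall _ (by simpa using hc)

theorem Valued.exists_tendsto [CompleteSpace K] {f : ℕ → K}
    (hf : ∀ n, Valued.v (f (n + 1) - f n) ≤ exp (-(n : ℤ))) :
    ∃ a, Tendsto f atTop (𝓝 a) := by
  have := Valued.nonarchimedeanAddGroup (K := K)
  exact cauchySeq_tendsto_of_complete (NonarchimedeanAddGroup.cauchySeq_of_tendsto_sub_nhds_zero
    (Valued.tendsto_zero_of_le tendsto_id hf))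

theorem Valued.sub_le_of_tendsto {f : ℕ → K} {a π : K}
    (hf : ∀ n, Valued.v (f (n + 1) - f n) ≤ Valued.v π ^ n) (hπ1 : Valued.v π ≤ 1)
    (ha : Tendsto f atTop (𝓝 a)) (n : ℕ) : Valued.v (a - f n) ≤ Valued.v π ^ n := by
  have h1 : ∀ m, Valued.v (f (n + m) - f n) ≤ Valued.v (π ^ n) := by
    intro m
    induction m with
    | zero => simp
    | succ m ih =>
      rw [← sub_add_sub_cancel _ (f (n + m))]
      refine (Valuation.map_add _ _ _).trans (max_le ((hf (n + m)).trans ?_) ih)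
      rw [map_pow]
      exact pow_le_pow_right_of_le_one' hπ1 (Nat.le_add_right n m)
  rw [← map_pow]
  refine (Valued.isClosed_setOf_le (π ^ n)).mem_of_tendsto
    (((ha.comp (tendsto_add_atTop_nat n)).sub_const (f n))) (Eventually.of_forall fun m => ?_)
  rw [Function.comp_apply, add_comm m n]
  exact h1 m

end Valued

/-! ### Tate modules of rank one -/

namespace MonicPrime

open WithZero Filter Topology

variable {F : Type*} [Field F] (g : MonicPrime F)

theorem valued_algebraMap (b : F[X]) :
    Valued.v (algebraMap F[X] g.kv b) = g.place.intValuation b := by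
  rw [IsScalarTower.algebraMap_apply F[X] (RatFunc F) g.kv,
    ← IsDedekindDomain.HeightOneSpectrum.valuation_of_algebraMap (K := RatFunc F)]
  exact IsDedekindDomain.HeightOneSpectrum.valuedAdicCompletion_eq_valuation' g.place _

theorem valued_self : Valued.v (algebraMap F[X] g.kv g.1) = exp (-1 : ℤ) := by
  rw [valued_algebraMap, g.place.intValuation_singleton g.2.2.ne_zero rfl]

theorem valued_le_iff (b : F[X]) (n : ℕ) :
    Valued.v (algebraMap F[X] g.kv b) ≤ exp (-(n : ℤ)) ↔ g.1 ^ n ∣ b := by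
  rw [valued_algebraMap, IsDedekindDomain.HeightOneSpectrum.intValuation_le_pow_iff_mem,
    ← Ideal.mem_span_singleton, ← Ideal.span_singleton_pow]
  rfl

theorem algebraMap_kv_injective : Function.Injective (algebraMap F[X] g.kv) := by
  rw [IsScalarTower.algebraMap_eq F[X] (RatFunc F) g.kv]
  exact (algebraMap (RatFunc F) g.kv).injective.comp (IsFractionRing.injective F[X] (RatFunc F))

/-- A coherent sequence of polynomials modulo the powers of `g` has a limit in `A_v`. -/
theorem exists_limit {b : ℕ → F[X]} (hb : ∀ n, g.1 ^ n ∣ b (n + 1) - b n) :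
    ∃ a : g.Av, ∀ n, Valued.v ((a : g.kv) - algebraMap F[X] g.kv (b n)) ≤ exp (-(n : ℤ)) := by
  have hpow : ∀ n : ℕ, Valued.v (algebraMap F[X] g.kv g.1) ^ n = exp (-(n : ℤ)) := fun n => by
    rw [valued_self, ← exp_nsmul]
    simp
  have hd : ∀ n, Valued.v (algebraMap F[X] g.kv (b (n + 1)) - algebraMap F[X] g.kv (b n)) ≤
      exp (-(n : ℤ)) := fun n => by
    rw [← map_sub, valued_le_iff]
    exact hb n
  obtain ⟨a, ha⟩ := Valued.exists_tendsto (f := fun n => algebraMap F[X] g.kv (b n)) hd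
  have hlim : ∀ n, Valued.v (a - algebraMap F[X] g.kv (b n)) ≤ exp (-(n : ℤ)) := fun n => by
    rw [← hpow]
    refine Valued.sub_le_of_tendsto (fun n => (hd n).trans (hpow n).ge) ?_ ha n
    rw [valued_self, ← exp_zero, exp_le_exp]
    omega
  refine ⟨⟨a, ?_⟩, hlim⟩
  change Valued.v a ≤ 1
  rw [← sub_add_cancel a (algebraMap F[X] g.kv (b 0))]
  refine (Valuation.map_add _ _ _).trans (max_le (by simpa using hlim 0) ?_)
  exact IsDedekindDomain.HeightOneSpectrum.coe_algebraMap_mem _ _ g.place (b 0)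

variable {E : Type*} [AddCommGroup E] [Module F[X] E]

theorem Tate.pow_smul (x : g.Tate E) (n m : ℕ) : g.1 ^ m • x.1 (n + m) = x.1 n := by
  induction m with
  | zero => simp
  | succ m ih => rw [pow_succ, mul_smul, ← add_assoc, x.2.2, ih]

/-- Divide a nonzero `g`-torsion point repeatedly by `g`. The sequence is `0` at index `0`, and the
chosen torsion point stands at index `1`. -/
theorem Tate.exists_apply_one_ne_zero (hdiv : ∀ y : E, ∃ x : E, g.1 • x = y)
    (htors : ∃ x : E, x ≠ 0 ∧ g.1 • x = 0) : ∃ x : g.Tate E, x.1 1 ≠ 0 := by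
  choose d hd using hdiv
  obtain ⟨z, hz, hgz⟩ := htors
  let x : ℕ → E := fun n => Nat.casesOn n 0 fun m => d^[m] z
  have hx2 : ∀ n, g.1 • x (n + 1) = x n := by
    intro n
    cases n with
    | zero => exact hgz
    | succ m =>
      change g.1 • d^[m + 1] z = d^[m] z
      rw [Function.iterate_succ_apply', hd]
  refine ⟨⟨x, fun n => ?_, hx2⟩, hz⟩
  induction n with
  | zero => simp [x]
  | succ n ih => rw [pow_succ, mul_smul, hx2, ih]

/-- For `n ≥ 1`, `g^(n-1) x_n = x_1 ≠ 0`, so the annihilator of `x_n` is exactly `(g^n)`. -/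
theorem Tate.pow_dvd_of_smul_eq_zero {x : g.Tate E} (hx : x.1 1 ≠ 0) {n : ℕ} {b : F[X]}
    (hb : b • x.1 n = 0) : g.1 ^ n ∣ b := by
  cases n with
  | zero => simp
  | succ n =>
    refine _root_.pow_dvd_of_smul_eq_zero g.2.2 (x.2.1 (n + 1)) ?_ hb
    rw [add_comm n 1, Tate.pow_smul]
    exact hx

theorem finrank_hom_eq_one {T : Type*} [AddCommGroup T] [Module g.Av T]
    (e : g.Av ≃ₗ[g.Av] T) : Module.finrank g.kv (T →ₗ[g.Av] g.kv) = 1 := by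
  have e1 : (T →ₗ[g.Av] g.kv) ≃ₗ[g.kv] (g.Av →ₗ[g.Av] g.kv) := e.symm.congrLeft g.kv g.kv
  have e2 : (g.Av →ₗ[g.Av] g.kv) ≃ₗ[g.kv] g.kv := LinearMap.ringLmapEquivSelf g.Av g.kv g.kv
  rw [(e1.trans e2).finrank_eq, Module.finrank_self]

variable [Fintype F]

/-- A coherent sequence with `x_1 ≠ 0` is a basis. At level `n` its multiples already number `r^{n
deg g}`, the upper bound `hcard` for `E[g^n]`, so `x_n` generates that group. -/
theorem Tate.exists_equiv (hdiv : ∀ y : E, ∃ x : E, g.1 • x = y)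
    (htors : ∃ x : E, x ≠ 0 ∧ g.1 • x = 0)
    (hcard : ∀ n, ∃ s : Finset E, s.card ≤ Fintype.card F ^ (n * g.1.natDegree) ∧
      ∀ y : E, g.1 ^ n • y = 0 → y ∈ s) : Nonempty (g.Av ≃ₗ[g.Av] g.Tate E) := by
  classical
  obtain ⟨x, hx⟩ := Tate.exists_apply_one_ne_zero g hdiv htors
  have hspan : ∀ n (y : E), g.1 ^ n • y = 0 → ∃ b : F[X], b • x.1 n = y := by
    intro n y hy
    obtain ⟨s, hs, hsy⟩ := hcard n
    obtain ⟨t, ht, htb⟩ := exists_finset_smul (pow_ne_zero n g.2.2.ne_zero) fun b hb =>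
      Tate.pow_dvd_of_smul_eq_zero g hx (n := n) (b := b) hb
    have hts : t ⊆ s := fun z hz => by
      obtain ⟨b, rfl⟩ := htb z hz
      exact hsy _ (by rw [smul_comm, x.2.1 n, smul_zero])
    have heq := Finset.eq_of_subset_of_card_le hts (by rwa [ht, natDegree_pow])
    exact htb y (heq ▸ hsy y hy)
  refine ⟨LinearEquiv.ofBijective (LinearMap.toSpanSingleton g.Av (g.Tate E) x) ⟨?_, ?_⟩⟩
  · rw [injective_iff_map_eq_zero]
    intro a ha
    rw [LinearMap.toSpanSingleton_apply] at ha
    -- If `a x = 0`, every approximation of `a` modulo `g^n` kills `x_n` and is divisible by `g^n`.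
    have h0 : ∀ n : ℕ, Valued.v (a : g.kv) ≤ exp (-(n : ℤ)) := by
      intro n
      have h1 : g.approx a n • x.1 n = 0 := congrFun (congrArg Subtype.val ha) n
      have h2 := (g.valued_le_iff _ n).2 (Tate.pow_dvd_of_smul_eq_zero g hx h1)
      rw [← sub_add_cancel (a : g.kv) (algebraMap F[X] g.kv (g.approx a n))]
      exact (Valuation.map_add _ _ _).trans (max_le (g.approx_spec a n) h2)
    by_contra hne
    have hv : Valued.v (a : g.kv) ≠ 0 := by
      rw [Valuation.ne_zero_iff]
      exact fun h => hne (Subtype.ext h)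
    obtain ⟨m, hm⟩ : ∃ m, Valued.v (a : g.kv) = exp m := ⟨_, (exp_log hv).symm⟩
    have h3 := h0 (1 - m).toNat
    rw [hm, exp_le_exp] at h3
    have := Int.self_le_toNat (1 - m)
    omega
  · intro y
    choose b hb using fun n => hspan n (y.1 n) (y.2.1 n)
    -- The coefficients found level by level are coherent, since `b (n+1) - b n` kills `x_n`; their
    -- limit is the required scalar.
    obtain ⟨a, ha⟩ := g.exists_limit (b := b) fun n => by
      refine Tate.pow_dvd_of_smul_eq_zero g hx ?_
      rw [sub_smul, hb n, ← x.2.2 n, smul_comm, hb (n + 1), y.2.2 n, sub_self]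
    refine ⟨a, Subtype.ext (funext fun n => ?_)⟩
    rw [LinearMap.toSpanSingleton_apply, Tate.smul_apply, g.approx_smul (ha n) (x.2.1 n), hb]

end MonicPrime

/-! ### The field `𝔽_r((1/θ))` -/

section Kinf

open WithZero Filter Topology

variable {F : Type*} [Field F]

open Classical in
theorem Kinf.completeSpace (F : Type*) [Field F] : CompleteSpace (Kinf F) := by
  let : UniformSpace (RatFunc F) := (RatFunc.inftyValued F).toUniformSpace
  exact inferInstanceAs (CompleteSpace (UniformSpace.Completion (RatFunc F)))

open Classical in
theorem Kinf.t2Space (F : Type*) [Field F] : T2Space (Kinf F) := by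
  let : UniformSpace (RatFunc F) := (RatFunc.inftyValued F).toUniformSpace
  exact inferInstanceAs (T2Space (UniformSpace.Completion (RatFunc F)))

open Classical in
theorem Kinf.denseRange (F : Type*) [Field F] : DenseRange (algebraMap (RatFunc F) (Kinf F)) := by
  let : UniformSpace (RatFunc F) := (RatFunc.inftyValued F).toUniformSpace
  exact UniformSpace.Completion.denseRange_coe (α := RatFunc F)

open Classical in
theorem Kinf.valued_algebraMap (x : RatFunc F) :
    Valued.v (algebraMap (RatFunc F) (Kinf F) x) = RatFunc.inftyValuation F x :=
  @Valued.extensionValuation_apply_coe (RatFunc F) _ _ _ (RatFunc.inftyValued F) x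

open Classical in
-- Density of `k`, applied to the ball of radius `|α/θ| < |α|`. This transfers information on `α ∈
-- K` to `k`, and hence to places of `k^sep`.
theorem Kinf.exists_sub_lt {α : Kinf F} (hα : α ≠ 0) :
    ∃ a : RatFunc F, Valued.v (α - algebraMap (RatFunc F) (Kinf F) a) < Valued.v α := by
  have hT : Valued.v (algebraMap (RatFunc F) (Kinf F) RatFunc.X) = exp 1 := by
    rw [Kinf.valued_algebraMap, RatFunc.inftyValuation.X]
  have hT0 : algebraMap (RatFunc F) (Kinf F) RatFunc.X ≠ 0 := by
    exact (_root_.map_ne_zero _).2 RatFunc.X_ne_zero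
  generalize algebraMap (RatFunc F) (Kinf F) RatFunc.X = t at hT hT0
  have ho := Valued.isOpen_setOf_le (div_ne_zero hα hT0)
  obtain ⟨a, ha⟩ := (Kinf.denseRange F).exists_mem_open
    (ho.preimage (continuous_const (y := α).sub continuous_id)) ⟨α, by simp⟩
  refine ⟨a, lt_of_le_of_lt ha ?_⟩
  rw [map_div₀, hT]
  rw [← exp_log ((Valuation.ne_zero_iff _).2 hα : Valued.v α ≠ 0), ← exp_sub, exp_lt_exp]
  omega

theorem Kinf.tendsto_zero {ι : Type*} {l : Filter ι} {f : ι → Kinf F} {c : Kinf F}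
    (hc : Valued.v c < 1) {n : ι → ℕ} (hn : Tendsto n l atTop)
    (hf : ∀ i, Valued.v (f i) ≤ Valued.v c ^ n i) : Tendsto f l (𝓝 0) := by
  refine Valued.tendsto_zero_of_le hn fun i => (hf i).trans ?_
  -- The value group is discrete, so `|c| < 1` already bounds `|c|` away from `1`.
  have h : Valued.v c ≤ exp (-1 : ℤ) := by
    rcases eq_or_ne (Valued.v c) 0 with h0 | h0
    · rw [h0]
      exact zero_le
    · rw [← exp_log h0] at hc ⊢
      rw [← exp_zero, exp_lt_exp] at hc
      rw [exp_le_exp]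
      omega
  calc Valued.v c ^ n i ≤ exp (-1 : ℤ) ^ n i := pow_le_pow_left₀ zero_le h _
    _ = exp (-(n i : ℤ)) := by rw [← exp_nsmul]; simp

theorem Kinf.valued_const_le (c : F) : Valued.v (algebraMap F (Kinf F) c) ≤ 1 := by
  classical
  have h : algebraMap F (Kinf F) c = algebraMap (RatFunc F) (Kinf F) (RatFunc.C c) := by
    rw [← RatFunc.algebraMap_C]
    rfl
  rw [h, Kinf.valued_algebraMap]
  rcases eq_or_ne c 0 with rfl | hc
  · simp
  · rw [RatFunc.inftyValuation.C _ hc]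

section OneUnitPow

variable (p : ℕ) [Fact p.Prime] [CharP F p]

theorem summable_oneUnitPow {u : Kinf F} (hu : Valued.v (u - 1) < 1) (y : ℤ_[p]) :
    Summable fun n : ℕ => algebraMap F (Kinf F)
      (ZMod.castHom (dvd_refl p) F (PadicInt.toZMod (Ring.choose y n))) * (u - 1) ^ n := by
  have := Kinf.completeSpace F
  have := Valued.nonarchimedeanAddGroup (K := Kinf F)
  refine NonarchimedeanAddGroup.summable_of_tendsto_cofinite_zero ?_
  rw [Nat.cofinite_eq_atTop]
  refine Kinf.tendsto_zero hu tendsto_id fun n => ?_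
  rw [map_mul, map_pow]
  exact mul_le_of_le_one_left' (Kinf.valued_const_le _)

/-- Pascal's rule for the binomial coefficients, summed term by term. -/
theorem oneUnitPow_add_one {u : Kinf F} (hu : Valued.v (u - 1) < 1) (y : ℤ_[p]) :
    oneUnitPow p u (y + 1) = u * oneUnitPow p u y := by
  have := Kinf.completeSpace F
  have := Kinf.t2Space F
  have h0 := (summable_oneUnitPow p hu (y + 1)).tsum_eq_zero_add
  have h1 := (summable_oneUnitPow p hu y)
  have h2 := (summable_nat_add_iff 1).2 h1
  have h3 := h1.tsum_eq_zero_add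
  have e : ∀ n : ℕ, algebraMap F (Kinf F) (ZMod.castHom (dvd_refl p) F
      (PadicInt.toZMod (Ring.choose (y + 1) (n + 1)))) * (u - 1) ^ (n + 1) =
      (u - 1) * (algebraMap F (Kinf F) (ZMod.castHom (dvd_refl p) F
        (PadicInt.toZMod (Ring.choose y n))) * (u - 1) ^ n) +
      algebraMap F (Kinf F) (ZMod.castHom (dvd_refl p) F
        (PadicInt.toZMod (Ring.choose y (n + 1)))) * (u - 1) ^ (n + 1) := by
    intro n
    rw [Ring.choose_succ_succ, map_add, map_add, map_add]
    ring
  rw [oneUnitPow, oneUnitPow, h0]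
  simp only [e]
  rw [(h1.mul_left (u - 1)).tsum_add h2, h1.tsum_mul_left]
  simp only [Ring.choose_zero_right, pow_zero] at h3 ⊢
  have e2 := sub_eq_iff_eq_add'.2 h3
  rw [← e2]
  ring

end OneUnitPow

theorem MonicPrime.oneUnit_sub_one_lt (f : MonicPrime F) : Valued.v (f.oneUnit - 1) < 1 := by
  classical
  have hT : Kinf.T F = algebraMap (RatFunc F) (Kinf F) RatFunc.X := by
    rw [Kinf.T, IsScalarTower.algebraMap_apply F[X] (RatFunc F) (Kinf F), RatFunc.algebraMap_X]
  have hT0 : (RatFunc.X : RatFunc F) ^ f.1.natDegree ≠ 0 := pow_ne_zero _ RatFunc.X_ne_zero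
  have h : f.oneUnit - 1 = algebraMap (RatFunc F) (Kinf F)
      (algebraMap F[X] (RatFunc F) (f.1 - X ^ f.1.natDegree) / RatFunc.X ^ f.1.natDegree) := by
    rw [MonicPrime.oneUnit, hT, IsScalarTower.algebraMap_apply F[X] (RatFunc F) (Kinf F),
      ← map_pow, ← map_div₀, ← map_one (algebraMap (RatFunc F) (Kinf F)), ← map_sub]
    congr 1
    rw [map_sub, map_pow, RatFunc.algebraMap_X, sub_div, div_self hT0]
  rw [h, Kinf.valued_algebraMap, map_div₀, map_pow, RatFunc.inftyValuation.X]
  rcases eq_or_ne (f.1 - X ^ f.1.natDegree) 0 with h0 | h0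
  · simp [h0]
  · have hlt : (f.1 - X ^ f.1.natDegree).natDegree < f.1.natDegree := by
      refine natDegree_lt_natDegree h0 ?_
      refine degree_sub_lt_left ?_ f.2.1.ne_zero ?_
      · rw [degree_X_pow, degree_eq_natDegree f.2.1.ne_zero]
      · rw [f.2.1.leadingCoeff, leadingCoeff_X_pow]
    have hv := RatFunc.inftyValuation.polynomial (F := F) h0
    rw [RatFunc.inftyValuation_apply, hv, ← exp_nsmul, ← exp_sub, ← exp_zero, exp_lt_exp]
    simpa using hlt

variable [Fintype F]

/-- The iteration `z ↦ u z^r` started at `1` converges, because `z ↦ z^r` is additive and contracts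
small differences. Its limit satisfies `π = u π^r` and is a one-unit, so `u = (π⁻¹)^(r-1)`. -/
theorem Kinf.exists_pow_card_sub_one_eq {u : Kinf F} (hu : Valued.v (u - 1) < 1) :
    ∃ α : Kinf F, u = α ^ (Fintype.card F - 1) := by
  have := Kinf.completeSpace F
  have := Kinf.t2Space F
  have hr : 1 < Fintype.card F := Fintype.one_lt_card
  let c : ℕ → Kinf F := fun n => (fun z => u * z ^ Fintype.card F)^[n] 1
  have hc : ∀ n, c (n + 1) = u * c n ^ Fintype.card F := fun n => Function.iterate_succ_apply' _ _ _
  have hvu : Valued.v u ≤ 1 := by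
    rw [← sub_add_cancel u 1]
    exact (Valuation.map_add _ _ _).trans (max_le hu.le (by simp))
  have hd : ∀ n, Valued.v (c (n + 1) - c n) ≤ Valued.v (u - 1) ^ (n + 1) := by
    intro n
    induction n with
    | zero => simp [c]
    | succ n ih =>
      have e : c (n + 1 + 1) - c (n + 1) = u * (c (n + 1) - c n) ^ Fintype.card F := by
        have := map_sub (FiniteField.frobeniusAlgHom F (Kinf F)) (c (n + 1)) (c n)
        simp only [FiniteField.coe_frobeniusAlgHom] at this
        rw [this, mul_sub, ← hc, ← hc]
      rw [e, map_mul, map_pow]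
      calc Valued.v u * Valued.v (c (n + 1) - c n) ^ Fintype.card F
          ≤ Valued.v (c (n + 1) - c n) ^ Fintype.card F := mul_le_of_le_one_left' hvu
        _ ≤ (Valued.v (u - 1) ^ (n + 1)) ^ Fintype.card F := pow_le_pow_left₀ zero_le ih _
        -- Here `(n+1) r ≥ n+2`, since `r ≥ 2`.
        _ ≤ Valued.v (u - 1) ^ (n + 1 + 1) := by
          rw [← pow_mul]
          exact pow_le_pow_right_of_le_one' hu.le (by nlinarith)
  have hd1 : ∀ n, Valued.v (c n - 1) ≤ Valued.v (u - 1) := by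
    intro n
    induction n with
    | zero => simp [c]
    | succ n ih =>
      rw [← sub_add_sub_cancel _ (c n)]
      refine (Valuation.map_add _ _ _).trans (max_le ((hd n).trans ?_) ih)
      exact (pow_le_pow_right_of_le_one' hu.le (Nat.le_add_left 1 n)).trans_eq (pow_one _)
  have := Valued.nonarchimedeanAddGroup (K := Kinf F)
  obtain ⟨π, hπ⟩ := cauchySeq_tendsto_of_complete
    (NonarchimedeanAddGroup.cauchySeq_of_tendsto_sub_nhds_zero (f := c)
      (Kinf.tendsto_zero hu (tendsto_add_atTop_nat 1) hd))
  have hfix : π = u * π ^ Fintype.card F := by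
    refine tendsto_nhds_unique (hπ.comp (tendsto_add_atTop_nat 1)) ?_
    have h : Tendsto (fun n => u * c n ^ Fintype.card F) atTop (𝓝 (u * π ^ Fintype.card F)) :=
      (hπ.pow _).const_mul u
    exact h.congr fun n => (hc n).symm
  have hπ1 : Valued.v (π - 1) < 1 := lt_of_le_of_lt
    ((Valued.isClosed_setOf_le (u - 1)).mem_of_tendsto (hπ.sub_const 1)
      (Eventually.of_forall hd1)) hu
  have hπ0 : π ≠ 0 := by
    rintro rfl
    simp [Valuation.map_neg] at hπ1
  refine ⟨π⁻¹, ?_⟩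
  obtain ⟨m, hm⟩ : ∃ m, Fintype.card F = m + 1 := ⟨_, (Nat.sub_add_cancel hr.le).symm⟩
  rw [hm, pow_succ, ← mul_assoc] at hfix
  have h1 : u * π ^ m = 1 := mul_right_cancel₀ hπ0 (by rw [← hfix, one_mul])
  rw [hm, Nat.add_sub_cancel, inv_pow]
  exact eq_inv_of_mul_eq_one_left h1

theorem Kinf.exists_one_add_inv_eq_pow : ∃ α : Kinf F,
    algebraMap (RatFunc F) (Kinf F) (1 + 1 / RatFunc.X) = α ^ (Fintype.card F - 1) := by
  classical
  refine Kinf.exists_pow_card_sub_one_eq ?_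
  rw [map_add, map_one, add_sub_cancel_left, Kinf.valued_algebraMap, RatFunc.inftyValuation.X_inv,
    ← exp_zero, exp_lt_exp]
  omega

end Kinf

/-! ### Polynomials over `A` evaluated in `k^sep`. -/

section SeparableClosure

variable {F : Type*} [Field F] {f g : MonicPrime F} {B : ValuationSubring (kSep F)}

instance kSep.isScalarTower (F : Type*) [Field F] : IsScalarTower F F[X] (kSep F) :=
  IsScalarTower.of_algebraMap_eq fun c => by
    rw [IsScalarTower.algebraMap_apply F (RatFunc F) (kSep F),
      IsScalarTower.algebraMap_apply F[X] (RatFunc F) (kSep F),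
      IsScalarTower.algebraMap_apply F F[X] (RatFunc F)]

theorem algebraMap_kSep_injective : Function.Injective (algebraMap F[X] (kSep F)) := by
  rw [IsScalarTower.algebraMap_eq F[X] (RatFunc F) (kSep F)]
  exact (algebraMap (RatFunc F) (kSep F)).injective.comp (IsFractionRing.injective F[X] (RatFunc F))

theorem aeval_mem_of_liesOverPrime (hB : LiesOverPrime B f) (Q : F[X][X]) {x : kSep F}
    (hx : x ∈ B) : aeval x Q ∈ B := by
  rw [aeval_eq_sum_range]
  refine sum_mem fun i _ => ?_
  rw [Algebra.smul_def]
  exact mul_mem (kSep_algebraMap_mem hB _) (pow_mem hx i)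

theorem not_dvd_pow_of_ne (hgf : g ≠ f) (n : ℕ) : ¬ f.1 ∣ g.1 ^ n := by
  intro h
  have h1 := (f.2.2.prime.dvd_of_dvd_pow h)
  have h2 := (f.2.2.dvd_irreducible_iff_associated g.2.2).1 h1
  exact hgf (Subtype.ext (eq_of_monic_of_associated g.2.1 f.2.1 h2.symm))

theorem aeval_galK_apply (σ : GalK F) (Q : F[X][X]) (x : kSep F) :
    aeval (σ x) Q = σ (aeval x Q) := by
  exact aeval_algHom_apply (σ.toAlgHom.restrictScalars F[X]) x Q

theorem Polynomial.separable_of_derivative_eq_C {L : Type*} [Field L] {P : L[X]} {c : L}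
    (hc : c ≠ 0) (hP : derivative P = C c) : P.Separable := by
  refine ⟨0, C c⁻¹, ?_⟩
  rw [hP, ← C_mul, inv_mul_cancel₀ hc]
  simp

theorem algebraMap_kSep_ne_zero (g : MonicPrime F) : algebraMap F[X] (kSep F) g.1 ≠ 0 :=
  (map_ne_zero_iff _ algebraMap_kSep_injective).2 g.2.2.ne_zero

end SeparableClosure

/-! ### Torsion points of the Carlitz module -/

section CarlitzTorsion

variable {F : Type*} [Field F] [Fintype F]

/-- The element of the `𝔽_r[T]`-module `ψ(k^sep)` given by an element of `k^sep`. -/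
abbrev DrinfeldModule.point (ψ : DrinfeldModule F (RatFunc F)) : kSep F ≃ₗ[F] ψ.SepPoints :=
  Module.AEval'.of (ψ.baseChange (kSep F)).psiEnd

theorem carlitz_smul_point (a : F[X]) (x : kSep F) :
    a • (carlitz F).point x = (carlitz F).point (aeval x (carlitzPoly a)) := by
  rw [DrinfeldModule.point, DrinfeldModule.smul_point, carlitz_psi, eval_map_algebraMap]

theorem carlitz_smul_point_eq_zero_iff (a : F[X]) (x : kSep F) :
    a • (carlitz F).point x = 0 ↔ aeval x (carlitzPoly a) = 0 := by
  rw [carlitz_smul_point, LinearEquiv.map_eq_zero_iff]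

theorem derivative_carlitzPoly_map (a : F[X]) :
    derivative ((carlitzPoly a).map (algebraMap F[X] (kSep F))) =
      C (algebraMap F[X] (kSep F) a) := by
  rw [derivative_map, derivative_carlitzPoly, map_C]

variable (g : MonicPrime F)

theorem one_lt_natDegree_carlitzPoly_map :
    1 < ((carlitzPoly g.1).map (algebraMap F[X] (kSep F))).natDegree := by
  rw [(carlitzPoly_monic_natDegree g.2.1).1.natDegree_map, (carlitzPoly_monic_natDegree g.2.1).2]
  exact Nat.one_lt_pow g.2.2.natDegree_pos.ne' Fintype.one_lt_card

/-- The polynomial `C_g(X) - y` has constant nonzero derivative `g`, so it is separable and has a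
root in `k^sep`. -/
theorem carlitz_exists_smul_eq (y : (carlitz F).SepPoints) :
    ∃ x : (carlitz F).SepPoints, g.1 • x = y := by
  obtain ⟨y, rfl⟩ := (carlitz F).point.surjective y
  have hs : ((carlitzPoly g.1).map (algebraMap F[X] (kSep F)) - C y).Separable :=
    separable_of_derivative_eq_C (algebraMap_kSep_ne_zero g) (by
      rw [derivative_sub, derivative_C, sub_zero, derivative_carlitzPoly_map])
  have hd : ((carlitzPoly g.1).map (algebraMap F[X] (kSep F)) - C y).degree ≠ 0 := by
    refine (natDegree_pos_iff_degree_pos.1 ?_).ne'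
    rw [natDegree_sub_C]
    exact zero_lt_one.trans (one_lt_natDegree_carlitzPoly_map g)
  obtain ⟨x, hx⟩ := IsSepClosed.exists_root _ hd hs
  refine ⟨(carlitz F).point x, ?_⟩
  rw [IsRoot.def, eval_sub, eval_C, sub_eq_zero, eval_map_algebraMap] at hx
  rw [carlitz_smul_point, hx]

/-- A root of the separable polynomial `C_g(X)/X` works; it is nonzero because the constant term of
this quotient is `g ≠ 0`. -/
theorem carlitz_exists_torsion : ∃ x : (carlitz F).SepPoints, x ≠ 0 ∧ g.1 • x = 0 := by
  set P := (carlitzPoly g.1).map (algebraMap F[X] (kSep F)) with hP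
  have hPs : P.Separable :=
    separable_of_derivative_eq_C (algebraMap_kSep_ne_zero g) (derivative_carlitzPoly_map _)
  have hPX : P = P.divX * X := by
    conv_lhs => rw [← divX_mul_X_add P]
    rw [hP, coeff_map, carlitzPoly_coeff_zero]
    simp
  have hs : P.divX.Separable := by
    rw [hPX] at hPs
    exact hPs.of_mul_left
  have hd : P.divX.degree ≠ 0 := by
    refine (natDegree_pos_iff_degree_pos.1 ?_).ne'
    rw [natDegree_divX_eq_natDegree_tsub_one]
    exact Nat.sub_pos_of_lt (one_lt_natDegree_carlitzPoly_map g)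
  obtain ⟨x, hx⟩ := IsSepClosed.exists_root _ hd hs
  refine ⟨(carlitz F).point x, ?_, ?_⟩
  · rw [Ne, LinearEquiv.map_eq_zero_iff]
    rintro rfl
    have h1 : P.derivative.coeff 0 = algebraMap F[X] (kSep F) g.1 := by
      rw [hP, derivative_carlitzPoly_map, coeff_C_zero]
    rw [coeff_derivative, ← coeff_divX, coeff_zero_eq_eval_zero, hx] at h1
    exact algebraMap_kSep_ne_zero g (by rw [← h1]; simp)
  · rw [carlitz_smul_point_eq_zero_iff, ← eval_map_algebraMap, ← hP, hPX, eval_mul, hx, zero_mul]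

theorem carlitz_exists_finset (n : ℕ) : ∃ s : Finset (carlitz F).SepPoints,
    s.card ≤ Fintype.card F ^ (n * g.1.natDegree) ∧
      ∀ y : (carlitz F).SepPoints, g.1 ^ n • y = 0 → y ∈ s := by
  classical
  have hm := carlitzPoly_monic_natDegree (g.2.1.pow n)
  refine ⟨((carlitzPoly (g.1 ^ n)).map (algebraMap F[X] (kSep F))).roots.toFinset.image
    (carlitz F).point, ?_, fun y hy => ?_⟩
  · refine Finset.card_image_le.trans ((Multiset.toFinset_card_le _).trans ((card_roots' _).trans ?_))
    rw [hm.1.natDegree_map, hm.2, natDegree_pow]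
  · obtain ⟨y, rfl⟩ := (carlitz F).point.surjective y
    refine Finset.mem_image_of_mem _ ?_
    rw [Multiset.mem_toFinset, mem_roots (hm.1.map _).ne_zero, IsRoot.def, eval_map_algebraMap]
    exact (carlitz_smul_point_eq_zero_iff _ _).1 hy

theorem carlitz_tateModule_equiv : Nonempty (g.Av ≃ₗ[g.Av] (carlitz F).TateModule g) :=
  MonicPrime.Tate.exists_equiv g (carlitz_exists_smul_eq g) (carlitz_exists_torsion g)
    (carlitz_exists_finset g)

theorem carlitz_finrank_H1 : Module.finrank g.kv ((carlitz F).H1 g) = 1 := by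
  obtain ⟨e⟩ := carlitz_tateModule_equiv g
  exact g.finrank_hom_eq_one e

/-! ### Good reduction of the Carlitz module -/

variable {g} {f : MonicPrime F} {B : ValuationSubring (kSep F)}

theorem carlitz_torsion_mem (hB : LiesOverPrime B f) {a : F[X]} (ha : a.Monic) {x : kSep F}
    (hx : aeval x (carlitzPoly a) = 0) : x ∈ B :=
  ValuationSubring.mem_of_mem_integralClosure (A := F[X]) (kSep_algebraMap_mem hB)
    ⟨carlitzPoly a, (carlitzPoly_monic_natDegree ha).1, hx⟩

/-- Reduction at `f` is injective on torsion prime to `f`: in `x (a + x(...)) = 0` the second factor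
is a unit of `B` when `x` is in the maximal ideal. -/
theorem carlitz_torsion_eq_zero (hB : LiesOverPrime B f) {a : F[X]} (ha : ¬ f.1 ∣ a) {x : kSep F}
    (hxB : x ∈ B.nonunits) (hx : aeval x (carlitzPoly a) = 0) : x = 0 := by
  have hxB' : x ∈ B := B.nonunits_subset hxB
  rw [carlitzPoly_eq] at hx
  simp only [map_add, map_mul, aeval_C, aeval_X, map_pow] at hx
  have h : x * (algebraMap F[X] (kSep F) a + x * aeval x (carlitzPoly a).divX.divX) = 0 := by
    rw [← hx]
    ring
  rcases mul_eq_zero.1 h with h | h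
  · exact h
  · rw [← kSep_algebraMap_mem_nonunits_iff hB, eq_neg_of_add_eq_zero_left h] at ha
    exact absurd (B.nonunits_neg (B.nonunits_mul hxB (aeval_mem_of_liesOverPrime hB _ hxB'))) ha

theorem aeval_carlitzPoly_add (a : F[X]) (x y : kSep F) :
    aeval (x + y) (carlitzPoly a) = aeval x (carlitzPoly a) + aeval y (carlitzPoly a) := by
  apply (carlitz F).point.injective
  rw [map_add, ← carlitz_smul_point, ← carlitz_smul_point, ← carlitz_smul_point, map_add, smul_add]

theorem aeval_carlitzPoly_sub (a : F[X]) (x y : kSep F) :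
    aeval (x - y) (carlitzPoly a) = aeval x (carlitzPoly a) - aeval y (carlitzPoly a) := by
  rw [eq_sub_iff_add_eq, ← aeval_carlitzPoly_add, sub_add_cancel]

theorem aeval_carlitzPoly_comm (a b : F[X]) (x : kSep F) :
    aeval (aeval x (carlitzPoly a)) (carlitzPoly b) =
      aeval (aeval x (carlitzPoly b)) (carlitzPoly a) := by
  apply (carlitz F).point.injective
  rw [← carlitz_smul_point, ← carlitz_smul_point, ← carlitz_smul_point, ← carlitz_smul_point,
    smul_comm]

/-- The difference `τx - x` is again `g^n`-torsion and reduces to `0`. -/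
theorem carlitz_inertia_apply (hB : LiesOverPrime B f) (hgf : g ≠ f)
    {τ : B.decompositionSubgroup (RatFunc F)} (hτ : τ ∈ B.inertiaSubgroup (RatFunc F)) {n : ℕ}
    {x : kSep F} (hx : aeval x (carlitzPoly (g.1 ^ n)) = 0) : (τ : GalK F) x = x := by
  rw [← sub_eq_zero]
  refine carlitz_torsion_eq_zero hB (not_dvd_pow_of_ne hgf n)
    ((B.mem_inertiaSubgroup_iff τ).1 hτ x (carlitz_torsion_mem hB (g.2.1.pow n) hx)) ?_
  rw [aeval_carlitzPoly_sub, aeval_galK_apply, hx, map_zero, sub_zero]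

/-- Both sides are `g^n`-torsion points congruent to `x^{r^{deg f}}`, the left one by the definition
of Frobenius and the right one because `C_f ≡ X^{r^{deg f}}` modulo `f`. Injectivity of reduction
makes them equal. -/
theorem carlitz_frob_apply (hB : LiesOverPrime B f) (hgf : g ≠ f) {σ : GalK F}
    (hσ : IsGeomFrob B f σ) {n : ℕ} {x : kSep F} (hx : aeval x (carlitzPoly (g.1 ^ n)) = 0) :
    σ⁻¹ x = aeval x (carlitzPoly f.1) := by
  have hxB := carlitz_torsion_mem hB (g.2.1.pow n) hx
  rw [← sub_eq_zero]
  refine carlitz_torsion_eq_zero hB (not_dvd_pow_of_ne hgf n) ?_ ?_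
  · obtain ⟨Q, hQ⟩ := exists_carlitzPoly_eq_X_pow_add f.2.1 f.2.2
    rw [hQ, map_add, map_pow, aeval_X, map_mul, aeval_C, ← sub_sub]
    exact B.nonunits_sub (hσ.2 x hxB) (B.nonunits_mul
      ((kSep_algebraMap_mem_nonunits_iff hB _).2 dvd_rfl) (aeval_mem_of_liesOverPrime hB Q hxB))
  · rw [aeval_carlitzPoly_sub, aeval_galK_apply, aeval_carlitzPoly_comm, hx, map_zero, zero_sub,
      neg_eq_zero, ← coeff_zero_eq_aeval_zero', carlitzPoly_coeff_zero,
      map_zero]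

end CarlitzTorsion

/-! ### Kummer characters -/

section Kummer

variable {F : Type*} [Field F] {γ : kSep F} {χ : GalK F →* Fˣ}

/-- `χ` is the Kummer character given by the action of the Galois group on `γ`. -/
def IsKummerChar (χ : GalK F →* Fˣ) (γ : kSep F) : Prop :=
  ∀ σ : GalK F, σ γ = algebraMap F (kSep F) (χ σ) * γ

theorem galK_apply_const (σ : GalK F) (c : F) :
    σ (algebraMap F (kSep F) c) = algebraMap F (kSep F) c := by
  rw [IsScalarTower.algebraMap_apply F (RatFunc F) (kSep F), AlgEquiv.commutes]

theorem IsKummerChar.isContinuous (hχ : IsKummerChar χ γ) (hγ : γ ≠ 0) : IsContinuousChar χ := by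
  have h : ((χ.ker : Subgroup (GalK F)) : Set (GalK F)) = MulAction.stabilizer (GalK F) γ := by
    ext σ
    rw [SetLike.mem_coe, SetLike.mem_coe, MonoidHom.mem_ker, MulAction.mem_stabilizer_iff]
    change _ ↔ σ γ = γ
    rw [hχ σ]
    constructor
    · intro h
      rw [h]
      simp
    · intro h
      refine Units.ext ((algebraMap F (kSep F)).injective (mul_right_cancel₀ hγ ?_))
      rw [h]
      simp
  rw [IsContinuousChar, h]
  exact stabilizer_isOpen_of_isIntegral γ

theorem IsKummerChar.div (hχ : IsKummerChar χ γ) (a : RatFunc F) :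
    IsKummerChar χ (γ / algebraMap (RatFunc F) (kSep F) a) := fun σ => by
  rw [map_div₀, hχ σ, AlgEquiv.commutes, mul_div_assoc]

open scoped Pointwise

theorem conj_mem_decompositionSubgroup (B : ValuationSubring (kSep F)) {ρ σ : GalK F}
    (hσ : σ ∈ (ρ • B).decompositionSubgroup (RatFunc F)) :
    ρ⁻¹ * σ * ρ ∈ B.decompositionSubgroup (RatFunc F) := by
  have h : σ • ρ • B = ρ • B := hσ
  change (ρ⁻¹ * σ * ρ) • B = B
  rw [mul_smul, mul_smul, h, inv_smul_smul]

/-- Inertia groups of conjugate places are conjugate, and `χ` has commutative target. -/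
theorem trivial_on_inertia_smul (χ : GalK F →* Fˣ) {B : ValuationSubring (kSep F)}
    (h : ∀ τ ∈ B.inertiaSubgroup (RatFunc F), χ τ = 1) (ρ : GalK F) :
    ∀ τ ∈ (ρ • B).inertiaSubgroup (RatFunc F), χ τ = 1 := by
  intro τ hτ
  have h1 := h ⟨ρ⁻¹ * τ * ρ, conj_mem_decompositionSubgroup B τ.2⟩ (by
    rw [B.mem_inertiaSubgroup_iff]
    intro x hx
    have h2 := ((ρ • B).mem_inertiaSubgroup_iff τ).1 hτ (ρ x)
      (ValuationSubring.smul_mem_pointwise_smul ρ x B hx)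
    rw [ValuationSubring.smul_mem_nonunits_iff, map_sub] at h2
    have e : ρ⁻¹ (ρ x) = x := by rw [← AlgEquiv.mul_apply, inv_mul_cancel, AlgEquiv.one_apply]
    rw [e] at h2
    exact h2)
  simpa [mul_comm] using h1

end Kummer

/-! ### Existence of Kummer characters and their behaviour at infinity. -/

section Kummer

variable {F : Type*} [Field F] [Fintype F]

theorem prod_sub_algebraMap {L : Type*} [Field L] [Algebra F L] (x : L) :
    ∏ c : F, (x - algebraMap F L c) = x ^ Fintype.card F - x := by
  have hr : 1 < Fintype.card F := Fintype.one_lt_card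
  have hm : (X ^ Fintype.card F - X : F[X]).Monic := by
    refine monic_X_pow_sub ?_
    rw [degree_X]
    exact_mod_cast hr
  have hroots := FiniteField.roots_X_pow_card_sub_X F
  have hs : (X ^ Fintype.card F - X : F[X]).Splits := by
    rw [splits_iff_card_roots, hroots, FiniteField.X_pow_card_sub_X_natDegree_eq F hr]
    rfl
  have h := hs.eq_prod_roots_of_monic hm
  rw [hroots] at h
  have h2 := congrArg (aeval x) h
  simp only [map_sub, map_pow, aeval_X, map_multiset_prod, Multiset.map_map, Function.comp_def,
    aeval_C] at h2
  exact h2.symm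

theorem exists_unit_algebraMap_eq {L : Type*} [Field L] [Algebra F L] {x : L}
    (hx : x ^ (Fintype.card F - 1) = 1) : ∃ c : Fˣ, algebraMap F L c = x := by
  have hr : 1 < Fintype.card F := Fintype.one_lt_card
  have h : ∏ c : F, (x - algebraMap F L c) = 0 := by
    rw [prod_sub_algebraMap, ← Nat.sub_add_cancel hr.le, pow_succ, hx, one_mul, sub_self]
  obtain ⟨c, -, hc⟩ := Finset.prod_eq_zero_iff.1 h
  rw [sub_eq_zero] at hc
  have hc0 : c ≠ 0 := by
    rintro rfl
    rw [hc, map_zero, zero_pow (by omega)] at hx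
    exact zero_ne_one hx
  exact ⟨Units.mk0 c hc0, hc.symm⟩

/-- In `k^sep` the exponent `r - 1` equals `-1`, so it is invertible and the root is separable. -/
theorem exists_pow_eq_algebraMap (β : RatFunc F) :
    ∃ γ : kSep F, γ ^ (Fintype.card F - 1) = algebraMap (RatFunc F) (kSep F) β := by
  have hr : 1 < Fintype.card F := Fintype.one_lt_card
  have : NeZero ((Fintype.card F - 1 : ℕ) : kSep F) := ⟨by
    rw [Nat.cast_sub hr.le]
    have h : ((Fintype.card F : ℕ) : kSep F) = 0 := by
      rw [← map_natCast (algebraMap F (kSep F)), Nat.cast_card_eq_zero, map_zero]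
    rw [h]
    simp⟩
  exact IsSepClosed.exists_pow_nat_eq _ _

variable {γ : kSep F} {β : RatFunc F}

/-- The quotient `σγ/γ` is an `(r-1)`-st root of unity, hence a constant. Constants are fixed by
Galois, which gives multiplicativity. -/
theorem exists_isKummerChar (hγ : γ ≠ 0)
    (h : γ ^ (Fintype.card F - 1) = algebraMap (RatFunc F) (kSep F) β) :
    ∃ χ : GalK F →* Fˣ, IsKummerChar χ γ := by
  have hex : ∀ σ : GalK F, ∃ c : Fˣ, algebraMap F (kSep F) c = σ γ / γ := fun σ => by
    refine exists_unit_algebraMap_eq ?_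
    rw [div_pow, ← map_pow, h, AlgEquiv.commutes, div_self]
    rw [← h]
    exact pow_ne_zero _ hγ
  choose c hc using hex
  have hcs : ∀ σ : GalK F, σ γ = algebraMap F (kSep F) (c σ) * γ := fun σ => by
    rw [hc, div_mul_cancel₀ _ hγ]
  have hinj : ∀ {a b : Fˣ}, algebraMap F (kSep F) a * γ = algebraMap F (kSep F) b * γ → a = b :=
    fun hab => Units.ext ((algebraMap F (kSep F)).injective (mul_right_cancel₀ hγ hab))
  refine ⟨⟨⟨c, hinj ?_⟩, fun σ τ => hinj ?_⟩, hcs⟩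
  · rw [← hcs]
    simp
  · rw [← hcs, AlgEquiv.mul_apply, hcs τ, map_mul, galK_apply_const, hcs σ, Units.val_mul, map_mul]
    ring

variable {χ : GalK F →* Fˣ}

theorem const_notMem_nonunits (B : ValuationSubring (kSep F)) {c : F} (hc : c ≠ 0) :
    algebraMap F (kSep F) c ∉ B.nonunits := by
  have h1 : ∀ d : F, d ≠ 0 → algebraMap F (kSep F) d ∈ B := fun d hd => by
    have hd' : algebraMap F (kSep F) d ^ (Fintype.card F - 1) = 1 := by
      rw [← map_pow, FiniteField.pow_card_sub_one_eq_one d hd, map_one]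
    refine B.mem_of_valuation_le_one _ ?_
    have hr : 1 < Fintype.card F := Fintype.one_lt_card
    by_contra! hlt
    have h2 := one_lt_pow₀ hlt (n := Fintype.card F - 1) (by omega)
    rw [← map_pow, hd', map_one] at h2
    exact lt_irrefl _ h2
  intro h
  have h2 := B.nonunits_mul h (h1 c⁻¹ (inv_ne_zero hc))
  rw [← map_mul, mul_inv_cancel₀ hc, map_one] at h2
  exact B.one_notMem_nonunits h2

theorem const_mem (B : ValuationSubring (kSep F)) (c : F) : algebraMap F (kSep F) c ∈ B := by
  rcases eq_or_ne c 0 with rfl | hc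
  · simp
  · have h := const_notMem_nonunits B (inv_ne_zero hc)
    rw [B.mem_nonunits_iff_or] at h
    push Not at h
    rw [map_inv₀, inv_inv] at h
    exact h.2

open Classical in
-- Approximate `α` by `a ∈ k` and put `δ = γ/a`. Then `δ^(r-1) ≡ 1` at every place over `∞`, so `δ`
-- is congruent to a nonzero constant `c`. Applying `σ` in the decomposition group gives `χ(σ)c ≡
-- c`, and congruent constants are equal. Working with `δ` avoids embedding `k^sep` in an extension
-- of `K`.
theorem IsKummerChar.trivialAtInfinity (hχ : IsKummerChar χ γ) (hγ : γ ≠ 0)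
    (h : γ ^ (Fintype.card F - 1) = algebraMap (RatFunc F) (kSep F) β) {α : Kinf F}
    (hα : algebraMap (RatFunc F) (Kinf F) β = α ^ (Fintype.card F - 1)) :
    TrivialAtInfinity χ := by
  have hr : 1 < Fintype.card F := Fintype.one_lt_card
  have hβ : β ≠ 0 := by
    rintro rfl
    rw [map_zero] at h
    exact hγ (pow_eq_zero_iff (by omega) |>.1 h)
  have hα0 : α ≠ 0 := by
    rintro rfl
    rw [zero_pow (by omega), map_eq_zero] at hα
    exact hβ hα
  obtain ⟨a, ha⟩ := Kinf.exists_sub_lt hα0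
  have hav : Valued.v (algebraMap (RatFunc F) (Kinf F) a) = Valued.v α := by
    rw [Valuation.map_sub_swap] at ha
    exact Valuation.map_eq_of_sub_lt _ ha
  have ha0 : a ≠ 0 := by
    rintro rfl
    rw [map_zero, map_zero, eq_comm, map_eq_zero] at hav
    exact hα0 hav
  have hu : RatFunc.inftyValuation F (β / a ^ (Fintype.card F - 1) - 1) < 1 := by
    have ha1 : Valued.v (α / algebraMap (RatFunc F) (Kinf F) a - 1) < 1 := by
      have h0 : algebraMap (RatFunc F) (Kinf F) a ≠ 0 := (_root_.map_ne_zero _).2 ha0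
      rw [div_sub_one h0, map_div₀, hav, div_lt_one₀ (zero_lt_iff.2 ((Valuation.ne_zero_iff _).2 hα0))]
      exact ha
    rw [← Kinf.valued_algebraMap, map_sub, map_div₀, hα, map_pow, ← div_pow, map_one]
    generalize α / algebraMap (RatFunc F) (Kinf F) a = z at ha1
    have hz : Valued.v z ≤ 1 := by
      rw [← sub_add_cancel z 1]
      exact (Valuation.map_add _ _ _).trans (max_le ha1.le (by simp))
    rw [← mul_geom_sum, map_mul]
    refine mul_lt_one_of_lt_of_le ha1 (Valuation.map_sum_le _ fun i _ => ?_)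
    rw [map_pow]
    exact pow_le_one₀ zero_le hz
  intro B hB σ hσ
  set δ := γ / algebraMap (RatFunc F) (kSep F) a with hδ
  have hδ1 : δ ^ (Fintype.card F - 1) - 1 ∈ B.nonunits := by
    rw [hδ, div_pow, h, ← map_pow, ← map_div₀, ← map_one (algebraMap (RatFunc F) (kSep F)),
      ← map_sub, ValuationSubring.algebraMap_mem_nonunits_iff hB]
    exact hu
  have hδB : δ ∈ B := by
    refine B.mem_of_valuation_le_one _ ?_
    by_contra! hlt
    have h2 := one_lt_pow₀ hlt (n := Fintype.card F - 1) (by omega)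
    rw [← map_pow, ← not_le, B.valuation_le_one_iff] at h2
    rw [← sub_add_cancel (δ ^ (Fintype.card F - 1)) 1] at h2
    exact h2 (add_mem (B.nonunits_subset hδ1) (one_mem _))
  -- The product is `δ^r - δ`; one factor must then lie in the maximal ideal.
  have hprod : ∏ c : F, (δ - algebraMap F (kSep F) c) ∈ B.nonunits := by
    have e : δ ^ Fintype.card F - δ = (δ ^ (Fintype.card F - 1) - 1) * δ := by
      rw [sub_mul, one_mul, ← pow_succ, Nat.sub_add_cancel hr.le]
    rw [prod_sub_algebraMap, e]
    exact B.nonunits_mul hδ1 hδB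
  obtain ⟨c, hc⟩ : ∃ c : F, δ - algebraMap F (kSep F) c ∈ B.nonunits := by
    by_contra! hall
    rw [B.mem_nonunits_iff, map_prod, Finset.prod_eq_one, lt_self_iff_false] at hprod
    · exact hprod
    · intro c _
      refine le_antisymm ((B.valuation_le_one_iff _).2 (sub_mem hδB (const_mem B c))) ?_
      simpa [B.mem_nonunits_iff] using hall c
  have hc0 : c ≠ 0 := by
    rintro rfl
    rw [map_zero, sub_zero] at hc
    have h1 : δ ^ (Fintype.card F - 1) ∈ B.nonunits := by
      obtain ⟨m, hm⟩ : ∃ m, Fintype.card F - 1 = m + 1 := ⟨Fintype.card F - 2, by omega⟩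
      rw [hm, pow_succ']
      exact B.nonunits_mul hc (pow_mem hδB m)
    refine B.one_notMem_nonunits ?_
    rw [← sub_sub_cancel (δ ^ (Fintype.card F - 1)) 1]
    exact B.nonunits_sub h1 hδ1
  have hσc := (B.apply_mem_nonunits_iff hσ).2 hc
  rw [map_sub, galK_apply_const, hχ.div a σ] at hσc
  have h3 := B.nonunits_mul hc (const_mem B (χ σ))
  have h4 := B.nonunits_sub hσc h3
  have h5 : algebraMap F (kSep F) (χ σ) * δ - algebraMap F (kSep F) c -
      (δ - algebraMap F (kSep F) c) * algebraMap F (kSep F) (χ σ) =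
      algebraMap F (kSep F) (c * ((χ σ : F) - 1)) := by
    simp only [map_mul, map_sub, map_one]
    ring
  rw [h5] at h4
  have h6 : c * ((χ σ : F) - 1) = 0 := by
    by_contra hne
    exact const_notMem_nonunits B hne h4
  exact Units.ext (sub_eq_zero.1 ((mul_eq_zero.1 h6).resolve_left hc0))

/-! ### Local factors of characters -/

section LocalFactors

open scoped Pointwise

variable (χ) (f : MonicPrime F) (B : ValuationSubring (kSep F))

variable {B f} in
theorem IsGeomFrob.conj {ρ σ : GalK F} (hσ : IsGeomFrob (ρ • B) f σ) :
    IsGeomFrob B f (ρ⁻¹ * σ * ρ) := by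
  refine ⟨conj_mem_decompositionSubgroup B hσ.1, fun x hx => ?_⟩
  have h := hσ.2 (ρ x) (ValuationSubring.smul_mem_pointwise_smul ρ x B hx)
  rw [ValuationSubring.smul_mem_nonunits_iff, map_sub, map_pow] at h
  have e : ρ⁻¹ (ρ x) = x := by rw [← AlgEquiv.mul_apply, inv_mul_cancel, AlgEquiv.one_apply]
  rw [e] at h
  have e2 : (ρ⁻¹ * σ * ρ)⁻¹ x = ρ⁻¹ (σ⁻¹ (ρ x)) := by
    rw [mul_inv_rev, mul_inv_rev, inv_inv]
    rfl
  rw [e2]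
  exact h

variable {B f} in
-- Inverses of two geometric Frobenius elements act alike on the residue field, so `σ⁻¹σ'` is in the
-- inertia group.
theorem IsGeomFrob.apply_eq (h : ∀ τ ∈ B.inertiaSubgroup (RatFunc F), χ τ = 1) {σ σ' : GalK F}
    (hσ : IsGeomFrob B f σ) (hσ' : IsGeomFrob B f σ') : χ σ = χ σ' := by
  have h1 := h ⟨σ⁻¹ * σ', mul_mem (inv_mem hσ.1) hσ'.1⟩ (by
    rw [B.mem_inertiaSubgroup_iff]
    intro x hx
    change σ⁻¹ (σ' x) - x ∈ B.nonunits
    have hx' : σ' x ∈ B := (B.apply_mem_iff hσ'.1).2 hx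
    have h3 := B.nonunits_sub (hσ.2 _ hx') (hσ'.2 _ hx')
    have e : σ'⁻¹ (σ' x) = x := by rw [← AlgEquiv.mul_apply, inv_mul_cancel, AlgEquiv.one_apply]
    rwa [sub_sub_sub_cancel_right, e] at h3)
  rw [map_mul, map_inv, inv_mul_eq_one] at h1
  exact h1

/-- There is a constant which is `χ(Frob_f)` if `χ` is unramified at `f`, and `0` otherwise. -/
theorem exists_frobenius_value : ∃ c : F, ∀ B : ValuationSubring (kSep F), LiesOverPrime B f →
    ((∀ τ ∈ B.inertiaSubgroup (RatFunc F), χ τ = 1) → ∀ σ : GalK F, IsGeomFrob B f σ → c = χ σ) ∧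
    ((¬ ∀ τ ∈ B.inertiaSubgroup (RatFunc F), χ τ = 1) → c = 0) := by
  by_cases hex : ∃ B : ValuationSubring (kSep F), LiesOverPrime B f ∧
      (∀ τ ∈ B.inertiaSubgroup (RatFunc F), χ τ = 1) ∧ ∃ σ : GalK F, IsGeomFrob B f σ
  · obtain ⟨B₀, hB₀, hun, σ₀, hσ₀⟩ := hex
    refine ⟨χ σ₀, fun B hB => ?_⟩
    -- All places over `f` are conjugate and `χ` is invariant under conjugation, so one place
    -- decides ramification and the value.
    obtain ⟨ρ, rfl⟩ := exists_smul_eq_of_liesOverPrime hB₀ hB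
    refine ⟨fun _ σ hσ => ?_, fun hram => absurd (trivial_on_inertia_smul χ hun ρ) hram⟩
    rw [hσ₀.apply_eq χ hun hσ.conj]
    simp [mul_comm]
  · push Not at hex
    -- With no Frobenius at an unramified place, the first clause is vacuous, so existence of
    -- Frobenius elements is not needed.
    exact ⟨0, fun B hB => ⟨fun hun σ hσ => absurd hσ (hex B hB hun σ), fun _ => rfl⟩⟩

theorem isCharEulerPoly_of_frobenius_value {c : F}
    (hc : ∀ B : ValuationSubring (kSep F), LiesOverPrime B f →
      ((∀ τ ∈ B.inertiaSubgroup (RatFunc F), χ τ = 1) → ∀ σ : GalK F, IsGeomFrob B f σ → c = χ σ) ∧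
      ((¬ ∀ τ ∈ B.inertiaSubgroup (RatFunc F), χ τ = 1) → c = 0)) :
    IsCharEulerPoly χ f (1 - C (C c) * X) := fun B hB =>
  ⟨fun hun σ hσ => by rw [(hc B hB).1 hun σ hσ], fun hram => by rw [(hc B hB).2 hram]; simp⟩

end LocalFactors

end Kummer

/-! ### Some linear algebra -/

section LinearAlgebra

variable {K V W : Type*} [Field K] [AddCommGroup V] [Module K V] [AddCommGroup W] [Module K W]

theorem LinearMap.det_eq_mul_det_of_finrank_eq_one (hW : Module.finrank K W = 1) (e : V ≃ₗ[K] W)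
    (c : K) (φ : V →ₗ[K] V) (ψ : W →ₗ[K] W) (h : ∀ x, ψ (e x) = c • e (φ x)) :
    LinearMap.det ψ = c * LinearMap.det φ := by
  have he : ψ = c • ((e : V →ₗ[K] W) ∘ₗ φ ∘ₗ (e.symm : W →ₗ[K] V)) := by
    refine LinearMap.ext fun y => ?_
    obtain ⟨x, rfl⟩ := e.surjective y
    rw [h]
    simp
  rw [he, LinearMap.det_smul, hW, pow_one, LinearMap.det_conj]

theorem eq_zero_of_smul_eq_self {c : K} (hc : c ≠ 1) {x : V} (hx : c • x = x) : x = 0 := by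
  have h : (c - 1) • x = 0 := by rw [sub_smul, one_smul, hx, sub_self]
  exact (smul_eq_zero.1 h).resolve_left (sub_ne_zero.2 hc)

theorem Matrix.charpolyRev_const_fin_one (a : K) :
    (Matrix.of fun _ _ : Fin 1 => a).charpolyRev = 1 - C a * X := by
  unfold Matrix.charpolyRev
  rw [Matrix.det_fin_one]
  change (1 : Matrix (Fin 1) (Fin 1) K[X]) 0 0 - X * C a = _
  rw [Matrix.one_apply_eq, mul_comm]

end LinearAlgebra

/-! ### Twisting the Carlitz module -/

namespace MonicPrime

variable {F : Type*} [Field F] (g : MonicPrime F) {E E' : Type*} [AddCommGroup E] [Module F[X] E]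
  [AddCommGroup E'] [Module F[X] E']

/-- The isomorphism of Tate modules induced by an isomorphism of `𝔽_r[T]`-modules. -/
def Tate.congr (u : E ≃ₗ[F[X]] E') : g.Tate E ≃ₗ[g.Av] g.Tate E' where
  toFun x := ⟨fun n => u (x.1 n), fun n => by rw [← map_smul, x.2.1 n, map_zero],
    fun n => by rw [← map_smul, x.2.2 n]⟩
  invFun x := ⟨fun n => u.symm (x.1 n), fun n => by rw [← map_smul, x.2.1 n, map_zero],
    fun n => by rw [← map_smul, x.2.2 n]⟩
  left_inv x := by ext n; exact u.symm_apply_apply _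
  right_inv x := by ext n; exact u.apply_symm_apply _
  map_add' x y := by ext n; exact map_add u _ _
  map_smul' a x := by ext n; exact map_smul u _ _

/-- The image of a polynomial in `A_v`. -/
def toAv (b : F[X]) : g.Av :=
  ⟨algebraMap F[X] g.kv b, IsDedekindDomain.HeightOneSpectrum.coe_algebraMap_mem _ _ g.place b⟩

theorem toAv_smul_apply (b : F[X]) (x : g.Tate E) (n : ℕ) : (g.toAv b • x).1 n = b • x.1 n := by
  rw [Tate.smul_apply]
  refine g.approx_smul ?_ (x.2.1 n)
  rw [show ((g.toAv b : g.Av) : g.kv) = algebraMap F[X] g.kv b from rfl, sub_self, map_zero]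
  exact zero_le

theorem map_toAv_smul {T : Type*} [AddCommGroup T] [Module g.Av T] (h : T →ₗ[g.Av] g.kv)
    (b : F[X]) (x : T) : h (g.toAv b • x) = algebraMap F[X] g.kv b * h x := by
  rw [map_smul]
  rfl

end MonicPrime

section Twist

variable {F : Type*} [Field F] [Fintype F] {β : RatFunc F} (hβ : β ≠ 0) {γ : kSep F}

theorem carlitzTwist_psiEnd_apply (x : kSep F) :
    ((carlitzTwist β hβ).baseChange (kSep F)).psiEnd x =
      algebraMap F[X] (kSep F) X * x + algebraMap (RatFunc F) (kSep F) β * x ^ Fintype.card F := by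
  rw [DrinfeldModule.psiEnd_apply, carlitzTwist_psiT]
  simp

theorem carlitz_psiEnd_apply (x : kSep F) :
    ((carlitz F).baseChange (kSep F)).psiEnd x =
      algebraMap F[X] (kSep F) X * x + x ^ Fintype.card F := by
  rw [DrinfeldModule.psiEnd_apply, carlitz_psiT]
  simp

/-- Multiplication by `γ`, where `γ^(r-1) = β`, as an isomorphism `C^{(β)}(k^sep) → C(k^sep)`. -/
def twistEquiv (hγ : γ ≠ 0) (h : γ ^ (Fintype.card F - 1) = algebraMap (RatFunc F) (kSep F) β) :
    (carlitzTwist β hβ).SepPoints ≃ₗ[F[X]] (carlitz F).SepPoints :=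
  LinearEquiv.ofBijective
    (LinearMap.ofAEval _ ((carlitz F).point.toLinearMap.comp (LinearMap.mulLeft F γ)) fun x => by
      have hr : 1 < Fintype.card F := Fintype.one_lt_card
      rw [LinearMap.comp_apply, LinearMap.comp_apply]
      change _ = (X : F[X]) • (carlitz F).point (γ * x)
      rw [Module.AEval'.X_smul_of]
      refine congrArg (carlitz F).point ?_
      rw [carlitz_psiEnd_apply]
      change γ * ((carlitzTwist β hβ).baseChange (kSep F)).psiEnd x = _
      rw [carlitzTwist_psiEnd_apply, ← h, mul_pow, ← Nat.sub_add_cancel hr.le, pow_succ γ,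
        Nat.add_sub_cancel]
      ring)
    ⟨fun x y hxy => (carlitzTwist β hβ).point.symm.injective
        (mul_left_cancel₀ hγ ((carlitz F).point.injective hxy)),
      fun y => ⟨(carlitzTwist β hβ).point (γ⁻¹ * (carlitz F).point.symm y),
        (congrArg (carlitz F).point (mul_inv_cancel_left₀ hγ _)).trans
          ((carlitz F).point.apply_symm_apply y)⟩⟩

theorem twistEquiv_point (hγ : γ ≠ 0)
    (h : γ ^ (Fintype.card F - 1) = algebraMap (RatFunc F) (kSep F) β) (x : kSep F) :
    twistEquiv hβ hγ h ((carlitzTwist β hβ).point x) = (carlitz F).point (γ * x) := rfl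

theorem galPoint_point (ψ : DrinfeldModule F (RatFunc F)) (σ : GalK F) (x : kSep F) :
    ψ.galPoint σ (ψ.point x) = ψ.point (σ x) := rfl

theorem smul_const_point (ψ : DrinfeldModule F (RatFunc F)) (c : F) (x : kSep F) :
    (C c : F[X]) • ψ.point x = ψ.point (algebraMap F (kSep F) c * x) := by
  rw [← Algebra.smul_def, map_smul]
  exact algebraMap_smul F[X] c (ψ.point x)

/-- The isomorphism `H^1_v(C) → H^1_v(C^{(β)})` induced by multiplication by `γ`. -/
def twistH1 (hγ : γ ≠ 0) (h : γ ^ (Fintype.card F - 1) = algebraMap (RatFunc F) (kSep F) β)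
    (v : MonicPrime F) : (carlitz F).H1 v ≃ₗ[v.kv] (carlitzTwist β hβ).H1 v :=
  (MonicPrime.Tate.congr v (twistEquiv hβ hγ h)).symm.congrLeft v.kv v.kv

variable {χ : GalK F →* Fˣ}

theorem twistEquiv_galPoint (hχ : IsKummerChar χ γ) (hγ : γ ≠ 0)
    (h : γ ^ (Fintype.card F - 1) = algebraMap (RatFunc F) (kSep F) β) (σ : GalK F)
    (x : (carlitzTwist β hβ).SepPoints) :
    twistEquiv hβ hγ h ((carlitzTwist β hβ).galPoint σ⁻¹ x) =
      (C (χ σ : F) : F[X]) • (carlitz F).galPoint σ⁻¹ (twistEquiv hβ hγ h x) := by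
  obtain ⟨x, rfl⟩ := (carlitzTwist β hβ).point.surjective x
  rw [galPoint_point, twistEquiv_point, twistEquiv_point, galPoint_point, smul_const_point]
  congr 1
  -- The factor `χ(σ⁻¹)` coming from `γ` cancels `χ(σ)`. The inverse in the action on `H^1` is why
  -- the twist is by `χ` and not by `χ⁻¹`.
  rw [map_mul, hχ σ⁻¹, ← mul_assoc, ← mul_assoc, ← map_mul, map_inv, Units.mul_inv, map_one, one_mul]

theorem twistH1_h1Rep (hχ : IsKummerChar χ γ) (hγ : γ ≠ 0)
    (h : γ ^ (Fintype.card F - 1) = algebraMap (RatFunc F) (kSep F) β) (v : MonicPrime F)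
    (σ : GalK F) (φ : (carlitz F).H1 v) :
    (carlitzTwist β hβ).h1Rep v σ (twistH1 hβ hγ h v φ) =
      algebraMap F[X] v.kv (C (χ σ : F)) • twistH1 hβ hγ h v ((carlitz F).h1Rep v σ φ) := by
  refine LinearMap.ext fun x => ?_
  have e : MonicPrime.Tate.congr v (twistEquiv hβ hγ h)
      (MonicPrime.Tate.map v ((carlitzTwist β hβ).galPoint σ⁻¹) x) = v.toAv (C (χ σ : F)) •
      MonicPrime.Tate.map v ((carlitz F).galPoint σ⁻¹)
        (MonicPrime.Tate.congr v (twistEquiv hβ hγ h) x) := by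
    ext n
    rw [v.toAv_smul_apply]
    exact twistEquiv_galPoint hβ hχ hγ h σ (x.1 n)
  change φ (MonicPrime.Tate.congr v (twistEquiv hβ hγ h)
    (MonicPrime.Tate.map v ((carlitzTwist β hβ).galPoint σ⁻¹) x)) = _
  rw [e, v.map_toAv_smul]
  rfl

theorem carlitzTwist_finrank_H1 (v : MonicPrime F) :
    Module.finrank v.kv ((carlitzTwist β hβ).H1 v) = 1 := by
  have hr : 1 < Fintype.card F := Fintype.one_lt_card
  obtain ⟨γ, h⟩ := exists_pow_eq_algebraMap β
  have hγ : γ ≠ 0 := by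
    rintro rfl
    rw [zero_pow (by omega), eq_comm, map_eq_zero] at h
    exact hβ h
  exact (twistH1 hβ hγ h v).finrank_eq.symm.trans (carlitz_finrank_H1 v)

theorem carlitzTwist_rho (hχ : IsKummerChar χ γ) (hγ : γ ≠ 0)
    (h : γ ^ (Fintype.card F - 1) = algebraMap (RatFunc F) (kSep F) β) (v : MonicPrime F)
    (σ : GalK F) : (carlitzTwist β hβ).rho v σ =
      algebraMap F[X] v.kv (C (χ σ : F)) * (carlitz F).rho v σ :=
  LinearMap.det_eq_mul_det_of_finrank_eq_one (carlitzTwist_finrank_H1 hβ v) (twistH1 hβ hγ h v)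
    _ _ _ (twistH1_h1Rep hβ hχ hγ h v σ)

theorem carlitz_rho_ne_zero (v : MonicPrime F) (σ : GalK F) : (carlitz F).rho v σ ≠ 0 := by
  have h : (carlitz F).rho v σ * (carlitz F).rho v σ⁻¹ = 1 := by
    rw [DrinfeldModule.rho, DrinfeldModule.rho, ← map_mul, ← map_mul, mul_inv_cancel, map_one,
      map_one]
  exact left_ne_zero_of_mul_eq_one h

/-- A single `v` determines the character, since `ρ_{C,v}` is nowhere zero and `𝔽_r` embeds in
`k_v`. -/
theorem carlitzTwist_rho_iff (hχ : IsKummerChar χ γ) (hγ : γ ≠ 0)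
    (h : γ ^ (Fintype.card F - 1) = algebraMap (RatFunc F) (kSep F) β) (v : MonicPrime F)
    (χ' : GalK F →* Fˣ) : (∀ σ : GalK F, (carlitzTwist β hβ).rho v σ =
      algebraMap F[X] v.kv (C (χ' σ : F)) * (carlitz F).rho v σ) ↔ χ' = χ := by
  constructor
  · intro hall
    ext σ
    have h1 := hall σ
    rw [carlitzTwist_rho hβ hχ hγ h] at h1
    exact (C_injective (v.algebraMap_kv_injective
      (mul_right_cancel₀ (carlitz_rho_ne_zero v σ) h1))).symm
  · rintro rfl σ
    exact carlitzTwist_rho hβ hχ hγ h v σ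

/-! ### Local factors of the twists of the Carlitz module -/

variable {f v : MonicPrime F} {B : ValuationSubring (kSep F)}

theorem carlitz_h1Rep_inertia (hB : LiesOverPrime B f) (hv : v ≠ f)
    {τ : B.decompositionSubgroup (RatFunc F)} (hτ : τ ∈ B.inertiaSubgroup (RatFunc F))
    (φ : (carlitz F).H1 v) : (carlitz F).h1Rep v τ φ = φ := by
  refine LinearMap.ext fun x => congrArg φ ?_
  ext n
  change (carlitz F).galPoint (τ : GalK F)⁻¹ (x.1 n) = x.1 n
  have hx := x.2.1 n
  obtain ⟨y, hy⟩ := (carlitz F).point.surjective (x.1 n)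
  rw [← hy, carlitz_smul_point_eq_zero_iff] at hx
  rw [← hy, galPoint_point]
  exact congrArg _ (carlitz_inertia_apply hB hv (inv_mem hτ) hx)

theorem carlitz_h1Rep_frob (hB : LiesOverPrime B f) (hv : v ≠ f) {σ : GalK F}
    (hσ : IsGeomFrob B f σ) (φ : (carlitz F).H1 v) :
    (carlitz F).h1Rep v σ φ = algebraMap F[X] v.kv f.1 • φ := by
  have e : ∀ x, MonicPrime.Tate.map v ((carlitz F).galPoint σ⁻¹) x = v.toAv f.1 • x := by
    intro x
    ext n
    rw [v.toAv_smul_apply]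
    change (carlitz F).galPoint σ⁻¹ (x.1 n) = _
    have hx := x.2.1 n
    obtain ⟨y, hy⟩ := (carlitz F).point.surjective (x.1 n)
    rw [← hy, carlitz_smul_point_eq_zero_iff] at hx
    rw [← hy, galPoint_point, carlitz_frob_apply hB hv hσ hx, carlitz_smul_point]
  refine LinearMap.ext fun x => ?_
  change φ (MonicPrime.Tate.map v ((carlitz F).galPoint σ⁻¹) x) = _
  rw [e, v.map_toAv_smul]
  rfl

/-- Inertia at `f ≠ v` acts on the line `H^1_v(C^{(β)})` through `χ`, so the invariants are
everything or zero. The convention `c = 0` in the ramified case covers both with one formula. -/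
theorem carlitzTwist_isEulerPoly (hχ : IsKummerChar χ γ) (hγ : γ ≠ 0)
    (h : γ ^ (Fintype.card F - 1) = algebraMap (RatFunc F) (kSep F) β) (f : MonicPrime F) {c : F}
    (hc : ∀ B : ValuationSubring (kSep F), LiesOverPrime B f →
      ((∀ τ ∈ B.inertiaSubgroup (RatFunc F), χ τ = 1) → ∀ σ : GalK F, IsGeomFrob B f σ → c = χ σ) ∧
      ((¬ ∀ τ ∈ B.inertiaSubgroup (RatFunc F), χ τ = 1) → c = 0)) :
    (carlitzTwist β hβ).IsEulerPoly f (1 - C (C c * f.1) * X) := by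
  intro v hv B hB σ hσ
  have hin : ∀ τ ∈ B.inertiaSubgroup (RatFunc F), ∀ φ : (carlitzTwist β hβ).H1 v,
      (carlitzTwist β hβ).h1Rep v τ φ = algebraMap F[X] v.kv (C (χ τ : F)) • φ := by
    intro τ hτ φ
    obtain ⟨φ, rfl⟩ := (twistH1 hβ hγ h v).surjective φ
    rw [twistH1_h1Rep hβ hχ hγ h, carlitz_h1Rep_inertia hB hv hτ]
  by_cases hun : ∀ τ ∈ B.inertiaSubgroup (RatFunc F), χ τ = 1
  · obtain ⟨φ₀, hφ₀, hspan⟩ := finrank_eq_one_iff'.1 (carlitzTwist_finrank_H1 hβ v)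
    refine ⟨1, fun _ => φ₀, fun _ _ => algebraMap F[X] v.kv (C c * f.1), ?_, ?_, ?_, ?_⟩
    · exact LinearIndependent.of_subsingleton 0 hφ₀
    · intro φ
      refine ⟨fun _ τ hτ => ?_, fun _ => ?_⟩
      · rw [hin τ hτ, hun τ hτ]
        simp
      · obtain ⟨a, ha⟩ := hspan φ
        rw [← ha]
        exact Submodule.smul_mem _ _ (Submodule.subset_span ⟨0, rfl⟩)
    · intro i
      obtain ⟨φ, hφ⟩ := (twistH1 hβ hγ h v).surjective φ₀
      rw [← hφ, twistH1_h1Rep hβ hχ hγ h, carlitz_h1Rep_frob hB hv hσ, map_smul, smul_smul,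
        ← map_mul, (hc B hB).1 hun σ hσ]
      simp
    · refine Eq.trans ?_ (Matrix.charpolyRev_const_fin_one
        (algebraMap F[X] v.kv (C c * f.1))).symm
      rw [Polynomial.map_sub, Polynomial.map_one, Polynomial.map_mul, map_C, map_X]
  -- Some inertia element acts by a scalar other than `1`, so the invariants vanish: the basis is
  -- empty and the determinant is `1`.
  · refine ⟨0, Fin.elim0, 0, linearIndependent_empty_type, ?_, fun i => i.elim0, ?_⟩
    · intro φ
      rw [Set.range_eq_empty, Submodule.span_empty, Submodule.mem_bot]
      constructor
      · rintro rfl τ _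
        rw [map_zero]
      · intro hφ
        push Not at hun
        obtain ⟨τ, hτ, hne⟩ := hun
        have h1 := hφ τ hτ
        rw [hin τ hτ] at h1
        refine eq_zero_of_smul_eq_self (fun h2 => hne ?_) h1
        rw [← map_one (algebraMap F[X] v.kv)] at h2
        exact Units.ext (C_injective (v.algebraMap_kv_injective h2))
    · rw [(hc B hB).2 hun]
      simp [Matrix.charpolyRev]

end Twist

/-! ### `L`-series -/

section LSeries

variable {F : Type*} [Field F] (p : ℕ) [Fact p.Prime] [CharP F p]

theorem Kinf.T_ne_zero (F : Type*) [Field F] : Kinf.T F ≠ 0 := by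
  rw [Kinf.T, IsScalarTower.algebraMap_apply F[X] (RatFunc F) (Kinf F), RatFunc.algebraMap_X]
  exact (_root_.map_ne_zero _).2 RatFunc.X_ne_zero

theorem MonicPrime.oneUnit_mul (f : MonicPrime F) :
    f.oneUnit * Kinf.T F ^ f.1.natDegree = algebraMap F[X] (Kinf F) f.1 :=
  div_mul_cancel₀ _ (pow_ne_zero _ (Kinf.T_ne_zero F))

theorem PowerSeries.rescale_inv {K : Type*} [Field K] (a : K) (φ : PowerSeries K) :
    PowerSeries.rescale a φ⁻¹ = (PowerSeries.rescale a φ)⁻¹ := by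
  by_cases h : PowerSeries.constantCoeff φ = 0
  · have h' : PowerSeries.constantCoeff (PowerSeries.rescale a φ) = 0 := by
      rw [← PowerSeries.coeff_zero_eq_constantCoeff_apply, PowerSeries.coeff_rescale]
      simpa using h
    rw [PowerSeries.inv_eq_zero.2 h, PowerSeries.inv_eq_zero.2 h', map_zero]
  · have h' : PowerSeries.constantCoeff (PowerSeries.rescale a φ) ≠ 0 := by
      rw [← PowerSeries.coeff_zero_eq_constantCoeff_apply, PowerSeries.coeff_rescale]
      simpa using h
    rw [PowerSeries.eq_inv_iff_mul_eq_one h', ← map_mul, PowerSeries.inv_mul_cancel _ h, map_one]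

theorem eulerFactor_linear (f : MonicPrime F) (a : F[X]) (y : ℤ_[p]) :
    eulerFactor p f (1 - C a * X) y = (1 - PowerSeries.C (algebraMap F[X] (Kinf F) a *
      oneUnitPow p f.oneUnit (-y)) * PowerSeries.X ^ f.1.natDegree)⁻¹ := by
  rw [eulerFactor]
  simp [eval₂_sub, mul_assoc]

theorem PowerSeries.rescale_one_sub_C_mul_X_pow {K : Type*} [Field K] (t a : K) (d : ℕ) :
    PowerSeries.rescale t (1 - PowerSeries.C a * PowerSeries.X ^ d) =
      1 - PowerSeries.C (a * t ^ d) * PowerSeries.X ^ d := by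
  rw [map_sub, map_one]
  congr 1
  ext n
  rw [PowerSeries.coeff_rescale, PowerSeries.coeff_C_mul, PowerSeries.coeff_C_mul,
    PowerSeries.coeff_X_pow]
  split_ifs with h
  · rw [h]
    ring
  · simp

/-- This is `f · f^{-s} = f^{-(s-1)}`. In `f = ⟨f⟩ T^{deg f}`, the one-unit shifts the exponent `-y`
to `-(y-1)`, and the power of `T` is absorbed by rescaling the variable. -/
theorem eulerFactor_eq_rescale (f : MonicPrime F) (c : F) (y : ℤ_[p]) :
    eulerFactor p f (1 - C (C c * f.1) * X) y =
      PowerSeries.rescale (Kinf.T F) (eulerFactor p f (1 - C (C c) * X) (y - 1)) := by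
  rw [eulerFactor_linear, eulerFactor_linear, PowerSeries.rescale_inv]
  congr 1
  have e : -(y - 1) = -y + 1 := by ring
  rw [e, oneUnitPow_add_one p f.oneUnit_sub_one_lt, PowerSeries.rescale_one_sub_C_mul_X_pow,
    map_mul (algebraMap F[X] (Kinf F)), ← f.oneUnit_mul]
  congr 3
  ring

theorem LSeriesOf_eq_integralTranslate (c : MonicPrime F → F) :
    LSeriesOf p (fun f => 1 - C (C (c f) * f.1) * X) =
      integralTranslate p 1 (LSeriesOf p fun f => 1 - C (C (c f)) * X) := by
  funext y
  rw [integralTranslate, zpow_one]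
  ext n
  rw [PowerSeries.coeff_rescale, LSeriesOf, LSeriesOf, PowerSeries.coeff_mk, PowerSeries.coeff_mk,
    ← PowerSeries.coeff_rescale]
  congr 1
  have hinj : Function.Injective (PowerSeries.rescale (Kinf.T F)) :=
    PowerSeries.rescale_injective (Kinf.T_ne_zero F)
  -- Only `1` is sent to `1`, so rescaling commutes with `finprod` without any check that the
  -- support is finite.
  have hone : ∀ x : PowerSeries (Kinf F), PowerSeries.rescale (Kinf.T F) x = 1 → x = 1 :=
    fun x hx => hinj (hx.trans (map_one _).symm)
  have hmap : ∀ {ι : Sort _} (g : ι → PowerSeries (Kinf F)),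
      PowerSeries.rescale (Kinf.T F) (∏ᶠ i, g i) = ∏ᶠ i, PowerSeries.rescale (Kinf.T F) (g i) :=
    fun g => MonoidHom.map_finprod_of_preimage_one
      (PowerSeries.rescale (Kinf.T F) : PowerSeries (Kinf F) →+* PowerSeries (Kinf F)).toMonoidHom
      hone g
  rw [hmap]
  refine finprod_congr fun f => ?_
  refine Eq.trans ?_ (MonoidHom.map_finprod_of_preimage_one
      (PowerSeries.rescale (Kinf.T F) : PowerSeries (Kinf F) →+* PowerSeries (Kinf F)).toMonoidHom
      hone _).symm
  exact finprod_congr fun _ => eulerFactor_eq_rescale p f (c f) y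

end LSeries

/-! ### The main theorem -/

section Main

theorem one_add_one_div_X_ne_zero {F : Type*} [Field F] :
    (1 + 1 / RatFunc.X : RatFunc F) ≠ 0 := by
  classical
  intro h
  have h1 := congrArg (RatFunc.inftyValuation F) (eq_neg_of_add_eq_zero_right h)
  rw [RatFunc.inftyValuation.X_inv, Valuation.map_neg, map_one, ← WithZero.exp_zero,
    WithZero.exp_inj] at h1
  omega

variable {F : Type*} [Field F] [Fintype F] (p : ℕ) [Fact p.Prime] [CharP F p]

theorem ne_zero_of_pow_eq {M : Type*} [Field M] [Algebra (RatFunc F) M] {β : RatFunc F} (hβ : β ≠ 0)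
    {α : M} (h : algebraMap (RatFunc F) M β = α ^ (Fintype.card F - 1)) : α ≠ 0 := by
  have hr : 1 < Fintype.card F := Fintype.one_lt_card
  rintro rfl
  rw [zero_pow (by omega)] at h
  exact hβ ((map_eq_zero _).1 h)

theorem carlitzTwist_isomorphic {M : Type*} [Field M] [Algebra F[X] M] [Algebra (RatFunc F) M]
    [IsScalarTower F[X] (RatFunc F) M] {β : RatFunc F} (hβ : β ≠ 0) {α : M}
    (h : algebraMap (RatFunc F) M β = α ^ (Fintype.card F - 1)) :
    ((carlitzTwist β hβ).baseChange M).Isomorphic ((carlitz F).baseChange M) := by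
  have hα := ne_zero_of_pow_eq hβ h
  have hsupp : ∀ c : M, ∀ n ∈ (C c * X : M[X]).support, ∃ i : ℕ, n = Fintype.card F ^ i :=
    fun c n hn => ⟨0, by
      have := support_C_mul_X_subset c hn
      simpa using this⟩
  have hc : ∀ {a b : M}, a * b = 1 → (C a * X : M[X]).comp (C b * X) = X := fun {a b} hab => by
    rw [mul_comp, C_comp, X_comp, ← mul_assoc, ← C_mul, hab, C_1, one_mul]
  refine ⟨C α * X, C α⁻¹ * X, hsupp _, hsupp _, hc (mul_inv_cancel₀ hα), hc (inv_mul_cancel₀ hα),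
    fun a => ?_⟩
  rw [carlitzTwist_psi hβ h, ← comp_assoc, hc (mul_inv_cancel₀ hα), X_comp]

theorem exists_kummerChar_of_pow_eq {β : RatFunc F} (hβ : β ≠ 0) {α : Kinf F}
    (hα : algebraMap (RatFunc F) (Kinf F) β = α ^ (Fintype.card F - 1)) :
    ∃ (γ : kSep F) (χ : GalK F →* Fˣ), γ ≠ 0 ∧
      γ ^ (Fintype.card F - 1) = algebraMap (RatFunc F) (kSep F) β ∧ IsKummerChar χ γ ∧
      IsContinuousChar χ ∧ TrivialAtInfinity χ := by
  obtain ⟨γ, h⟩ := exists_pow_eq_algebraMap β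
  have hγ := ne_zero_of_pow_eq hβ h.symm
  obtain ⟨χ, hχ⟩ := exists_isKummerChar hγ h
  exact ⟨γ, χ, hγ, h, hχ, hχ.isContinuous hγ, hχ.trivialAtInfinity hγ h hα⟩

theorem carlitzTwist_isModularClassI {β : RatFunc F} (hβ : β ≠ 0) {α : Kinf F}
    (hα : algebraMap (RatFunc F) (Kinf F) β = α ^ (Fintype.card F - 1)) :
    (carlitzTwist β hβ).IsModularClassI p := by
  obtain ⟨γ, χ, hγ, h, hχ, hcont, hinf⟩ := exists_kummerChar_of_pow_eq hβ hα
  choose c hc using fun f => exists_frobenius_value χ f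
  exact ⟨χ, fun f => 1 - C (C (c f) * f.1) * X, fun f => 1 - C (C (c f)) * X, 1, hcont, hinf,
    fun f => carlitzTwist_isEulerPoly hβ hχ hγ h f (hc f),
    fun f => isCharEulerPoly_of_frobenius_value χ f (hc f), LSeriesOf_eq_integralTranslate p c⟩

end Main

theorem mainTheorem2 {F : Type*} [Field F] [Fintype F] (p : ℕ) [Fact p.Prime] [CharP F p] :
    (∀ (β : RatFunc F) (hβ : β ≠ 0) (α : Kinf F),
      algebraMap (RatFunc F) (Kinf F) β = α ^ (Fintype.card F - 1) →
        (∀ a : F[X], ((carlitzTwist β hβ).baseChange (Kinf F)).psi a =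
          (C α⁻¹ * X).comp ((((carlitz F).baseChange (Kinf F)).psi a).comp (C α * X))) ∧
        ((carlitzTwist β hβ).baseChange (Kinf F)).Isomorphic
          ((carlitz F).baseChange (Kinf F)) ∧
        (∀ v : MonicPrime F, Module.finrank v.kv ((carlitz F).H1 v) = 1 ∧
          Module.finrank v.kv ((carlitzTwist β hβ).H1 v) = 1) ∧
        (∃ χ : GalK F →* Fˣ, IsContinuousChar χ ∧ TrivialAtInfinity χ ∧
          ∀ (v : MonicPrime F) (χ' : GalK F →* Fˣ),
            (∀ σ : GalK F, (carlitzTwist β hβ).rho v σ =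
              algebraMap F[X] v.kv (C (χ' σ : F)) * (carlitz F).rho v σ) ↔ χ' = χ) ∧
        (carlitzTwist β hβ).IsModularClassI p) ∧
    (carlitz F).IsModularClassI p ∧
    ∃ hβ : (1 + 1 / RatFunc.X : RatFunc F) ≠ 0,
      (∃ α : Kinf F, algebraMap (RatFunc F) (Kinf F) (1 + 1 / RatFunc.X) =
        α ^ (Fintype.card F - 1)) ∧
      (carlitzTwist (1 + 1 / RatFunc.X) hβ).IsModularClassI p := by
  refine ⟨fun β hβ α hα => ⟨carlitzTwist_psi hβ hα, carlitzTwist_isomorphic hβ hα,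
    fun v => ⟨carlitz_finrank_H1 v, carlitzTwist_finrank_H1 hβ v⟩, ?_,
    carlitzTwist_isModularClassI p hβ hα⟩,
    -- The Carlitz module is by definition the twist with `β = 1`, and `1 = 1^(r-1)`.
    carlitzTwist_isModularClassI p (one_ne_zero (α := RatFunc F)) (α := 1) (by simp),
    one_add_one_div_X_ne_zero, Kinf.exists_one_add_inv_eq_pow, ?_⟩
  · obtain ⟨γ, χ, hγ, h, hχ, hcont, hinf⟩ := exists_kummerChar_of_pow_eq hβ hα
    exact ⟨χ, hcont, hinf, fun v χ' => carlitzTwist_rho_iff hβ hχ hγ h v χ'⟩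
  · obtain ⟨α, hα⟩ := Kinf.exists_one_add_inv_eq_pow (F := F)
    exact carlitzTwist_isModularClassI p _ hα

end
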